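/- **Setting.** Let $T\in(0,\infty)$, $r\ge 0$, $\alpha_0>0$, let $\mathcal O=\mathbb R$ or $\mathcal O=(0,\infty)$, and let $W$ be a one-dimensional Brownian motion relative to a filtration $\mathbb F$ on a probability space $(\Omega,\mathcal F,\mathsf P)$. Let $\mu,\sigma:\overline{\mathcal O}\to\mathbb R$, $g:[0,T]\to\mathbb R$, $h:[0,T]\times\overline{\mathcal O}\to\mathbb R$ satisfy the following. *Dynamics.* For each $x\in\mathcal O$ the uncontrolled equation $X^0_t=x+\int_0^t\mu(X^0_s)\,ds+\int_0^t\sigma(X^0_s)\,dW_s$ has an $\mathbb F$-adapted solution on $[0,T]$ that a.s. does not reach the end-points of $\mathcal O$. The function $\mu$ has linear growth, is $C^1$ on $\overline{\mathcal O}$ and convex, and $\mu_x$ is bounded from above and locally $\gamma$-Hölder in $\mathcal O$ for some $\gamma\in(0,1)$. If $\mathcal O=\mathbb R$ then $\sigma\equiv\sigma_0$ with $\sigma_0>0$; if $\mathcal O=(0,\infty)$ then $\mu(0)=0$ and $\sigma(x)=\sigma_1x$ with $\sigma_1>0$. *Payoffs.* $g\in C^1([0,T])$; $h$ is locally Hölder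 continuous (with an exponent in $(0,1)$) and $|h(t,x)|\le c(1+|x|^2)$ for some $c>0$; $h_x$ exists on $[0,T]\times\mathcal O$, is locally Hölder continuous (exponent in $(0,1)$), non-negative, non-decreasing in $x$ and non-increasing in $t$. With $\Theta(t,x)=\dot g(t)-rg(t)+h(t,x)$: $t\mapsto\Theta(t,x)$ is non-increasing on $[0,T]$ for every $x\in\overline{\mathcal O}$; $\Theta(0,0)<0$ if $\mathcal O=(0,\infty)$; $\inf_{[0,T]\times\mathcal O}\Theta=-K_1$ for some $K_1>0$; and $\sup_{x\in\mathcal O}\Theta(t,x)>0$ for all $t\in[0,T)$. *Game.* For $(t,x)\in[0,T]\times\mathcal O$ let $\mathcal T_t$ be the set of $\mathbb F$-stopping times with values in $[0,T-t]$ a.s. Let $\mathcal A_{t,x}$ be the set of controls $\nu=\nu^+-\nu^-$, where $\nu^\pm$ are $\mathbb F$-adapted, non-decreasing, càdlàg, with $\nu^\pm_{0-}=0$ and $\mathsf E[|\nu^\pm_{T-t}|^2]<\infty$, for which the controlled equation $$X^\nu_s=x+\int_0^s\mu(X^\nu_u)\,du+\int_0^s\sigma(X^\nu_u)\,dW_u+\nu_s,\qquad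 s\in[0,T-t],$$ has an $\mathbb F$-adapted càdlàg solution $X^\nu$ and, if $\mathcal O=(0,\infty)$, a.s. $X^\nu_s\ge 0$ for all $s\in[0,T-t]$ and $\nu^\pm$ is constant on $[\tau_{\mathcal O},T-t]$. Here $\tau_{\mathcal O}=\inf\{s\in[0,T-t]:X^\nu_s\notin\mathcal O\}$, with $\inf\varnothing=T-t$. For $\tau\in\mathcal T_t$ and $\nu\in\mathcal A_{t,x}$ let $$\mathcal J_{t,x}(\tau,\nu)=\mathsf E\Big[e^{-r(\tau\wedge\tau_{\mathcal O})}g(t+\tau\wedge\tau_{\mathcal O})+\int_0^{\tau\wedge\tau_{\mathcal O}}e^{-rs}h(t+s,X^\nu_s)\,ds+\int_{[0,\tau\wedge\tau_{\mathcal O}]}e^{-rs}\alpha_0\,d|\nu|_s\Big],$$ where $d|\nu|$ is the total variation measure of $\nu$ (including a possible jump at time $0$), and set $$\overline v(t,x)=\inf_{\nu\in\mathcal A_{t,x}}\sup_{\tau\in\mathcal T_t}\mathcal J_{t,x}(\tau,\nu),\qquad \underline v(t,x)=\sup_{\tau\in\mathcal T_t}\inf_{\nu\in\mathcal A_{t,x}}\mathcal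 J_{t,x}(\tau,\nu).$$ **Proposition 3.1.** For every $t\in[0,T]$ the maps $x\mapsto\overline v(t,x)$ and $x\mapsto\underline v(t,x)$ are non-decreasing on $\mathcal O$. In particular the value $v=\overline v=\underline v$ of the game satisfies: for every $t\in[0,T]$, $x\mapsto v(t,x)$ is non-decreasing on $\mathcal O$, and $v_x(t,x)\ge 0$ at every $x\in\mathcal O$ where the derivative exists. -/

import Mathlib

open MeasureTheory ProbabilityTheory Filter Topology Set
open scoped NNReal ENNReal

namespace StopperGame

noncomputable section

/-! ### Deterministic data of the game -/

/-- The deterministic data: horizon `T`, discount rate `r`, unit cost of control `α₀`, state space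
`O`, drift `μ`, volatility `σ`, terminal payoff `g` and running payoff `h` (time first). The
functions are only ever used on `closure O`, `[0,T]` and `[0,T] × closure O`. -/
structure GameData where
  T : ℝ
  r : ℝ
  α₀ : ℝ
  O : Set ℝ
  μ : ℝ → ℝ
  σ : ℝ → ℝ
  g : ℝ → ℝ
  h : ℝ → ℝ → ℝ

/-- Hölder continuity, with one exponent `γ ∈ (0,1)`, on every compact subset of `D`. -/
def LocallyHolderOn {E : Type*} [MetricSpace E] (f : E → ℝ) (D : Set E) : Prop :=
  ∃ γ : ℝ≥0, 0 < γ ∧ γ < 1 ∧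
    ∀ K : Set E, K ⊆ D → IsCompact K → ∃ C : ℝ≥0, HolderOnWith C γ f K

namespace GameData

variable (d : GameData)

/-- The constants of the problem and the two possible state spaces `ℝ` and `(0,∞)`. -/
structure BasicConditions : Prop where
  T_pos : 0 < d.T
  r_nonneg : 0 ≤ d.r
  α₀_pos : 0 < d.α₀
  O_cases : d.O = univ ∨ d.O = Ioi 0

/-- The conditions on the coefficients `μ` and `σ` of the dynamics. -/
structure CoefficientConditions : Prop where
  μ_growth : ∃ c : ℝ, ∀ x ∈ closure d.O, |d.μ x| ≤ c * (1 + |x|)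
  μ_contDiff : ContDiffOn ℝ 1 d.μ (closure d.O)
  μ_convex : ConvexOn ℝ (closure d.O) d.μ
  μ_deriv_holder : LocallyHolderOn (derivWithin d.μ (closure d.O)) d.O
  μ_deriv_bddAbove : ∃ c : ℝ, ∀ x ∈ closure d.O, derivWithin d.μ (closure d.O) x ≤ c
  μ_zero : d.O = Ioi 0 → d.μ 0 = 0
  σ_const : d.O = univ → ∃ σ₀ : ℝ, 0 < σ₀ ∧ ∀ x, d.σ x = σ₀
  σ_linear : d.O = Ioi 0 → ∃ σ₁ : ℝ, 0 < σ₁ ∧ ∀ x ∈ closure d.O, d.σ x = σ₁ * x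

/-- `Θ(t,x) = g'(t) - r g(t) + h(t,x)`. -/
def Θ (t x : ℝ) : ℝ := derivWithin d.g (Icc 0 d.T) t - d.r * d.g t + d.h t x

/-- The conditions on the payoff functions `g` and `h`. -/
structure PayoffConditions : Prop where
  g_contDiff : ContDiffOn ℝ 1 d.g (Icc 0 d.T)
  h_holder : LocallyHolderOn (fun p : ℝ × ℝ => d.h p.1 p.2) (Icc 0 d.T ×ˢ closure d.O)
  h_growth : ∃ c : ℝ, 0 < c ∧
    ∀ t ∈ Icc 0 d.T, ∀ x ∈ closure d.O, |d.h t x| ≤ c * (1 + |x| ^ 2)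
  h_diff : ∀ t ∈ Icc 0 d.T, DifferentiableOn ℝ (d.h t) d.O
  hx_holder : LocallyHolderOn (fun p : ℝ × ℝ => deriv (d.h p.1) p.2) (Icc 0 d.T ×ˢ d.O)
  hx_nonneg : ∀ t ∈ Icc 0 d.T, ∀ x ∈ d.O, 0 ≤ deriv (d.h t) x
  hx_mono : ∀ t ∈ Icc 0 d.T, MonotoneOn (fun x => deriv (d.h t) x) d.O
  hx_anti : ∀ x ∈ d.O, AntitoneOn (fun t => deriv (d.h t) x) (Icc 0 d.T)
  Θ_anti : ∀ x ∈ closure d.O, AntitoneOn (fun t => d.Θ t x) (Icc 0 d.T)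
  Θ_zero : d.O = Ioi 0 → d.Θ 0 0 < 0
  Θ_inf : ∃ K₁ : ℝ, 0 < K₁ ∧
    IsGLB ((fun p : ℝ × ℝ => d.Θ p.1 p.2) '' (Icc 0 d.T ×ˢ d.O)) (-K₁)
  Θ_sup : ∀ t ∈ Ico 0 d.T, ∃ x ∈ d.O, 0 < d.Θ t x

/-- The remaining time `T - t`. -/
def horizon (t : ℝ) : ℝ≥0 := (d.T - t).toNNReal

end GameData

/-! ### Stochastic integrals and the controlled dynamics -/

variable {Ω : Type*} {m : MeasurableSpace Ω}

/-- `W` is a standard one-dimensional Brownian motion relative to the filtration `F`. -/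
structure IsFiltrationBrownian (P : Measure Ω) (F : Filtration ℝ≥0 m) (W : ℝ≥0 → Ω → ℝ) :
    Prop where
  brownian : IsBrownianReal W P
  adapted : Adapted F W
  indep : ∀ s t : ℝ≥0, s ≤ t →
    Indep (MeasurableSpace.comap (fun ω => W t ω - W s ω) inferInstance) (F s) P

/-- Every path is right-continuous with finite left limits. -/
def IsCadlag (Y : ℝ≥0 → Ω → ℝ) : Prop :=
  ∀ ω, ∀ s : ℝ≥0, ContinuousWithinAt (fun u => Y u ω) (Ici s) s ∧
    ∃ l : ℝ, Tendsto (fun u => Y u ω) (𝓝[<] s) (𝓝 l)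

/-- `0 = p 0 ≤ p 1 ≤ ... ≤ p n = S` is a partition of `[0,S]` of mesh at most `δ`. -/
structure IsPartition (S : ℝ≥0) (δ : ℝ≥0) (n : ℕ) (p : ℕ → ℝ≥0) : Prop where
  mono : Monotone p
  first : p 0 = 0
  last : p n = S
  mesh : ∀ i < n, p (i + 1) ≤ p i + δ

/-- The sum `∑ H(p i) (W(p (i+1) ∧ s) - W(p i ∧ s))` along a partition. -/
def riemannSum (H W : ℝ≥0 → Ω → ℝ) (n : ℕ) (p : ℕ → ℝ≥0) (s : ℝ≥0) (ω : Ω) : ℝ :=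
  ∑ i ∈ Finset.range n, H (p i) ω * (W (min (p (i + 1)) s) ω - W (min (p i) s) ω)

/-- `I` is the Itô integral `∫ H dW` on `[0,S]`, for an adapted càdlàg integrand `H`: the
non-anticipating Riemann sums converge to `I` uniformly on `[0,S]` in probability as the mesh of
the partition of `[0,S]` tends to zero. -/
def IsItoIntegral (P : Measure Ω) (H W I : ℝ≥0 → Ω → ℝ) (S : ℝ≥0) : Prop :=
  ∀ ε : ℝ, 0 < ε → ∃ δ : ℝ≥0, 0 < δ ∧ ∀ (n : ℕ) (p : ℕ → ℝ≥0), IsPartition S δ n p →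
    P {ω | ∃ s ≤ S, ε ≤ |riemannSum H W n p s ω - I s ω|} ≤ ENNReal.ofReal ε

/-- `X` is an adapted càdlàg solution on `[0,S]` of
`X_s = x + ∫₀ˢ μ(X_u) du + ∫₀ˢ σ(X_u) dW_u + ν_s`, where `X_{0-} = x`. -/
structure IsSolution (d : GameData) (P : Measure Ω) (F : Filtration ℝ≥0 m) (W : ℝ≥0 → Ω → ℝ)
    (x : ℝ) (ν X : ℝ≥0 → Ω → ℝ) (S : ℝ≥0) : Prop where
  adapted : Adapted F X
  cadlag : IsCadlag X
  sde : ∃ I : ℝ≥0 → Ω → ℝ, IsItoIntegral P (fun s ω => d.σ (X s ω)) W I S ∧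
    ∀ᵐ ω ∂P, ∀ s ≤ S,
      X s ω = x + (∫ u in (0 : ℝ)..s, d.μ (X u.toNNReal ω)) + I s ω + ν s ω

/-- For every starting point in `O` the uncontrolled equation has an adapted solution on `[0,T]`,
and this solution does not reach the end-points of `O` on `[0,T]`. -/
def UncontrolledDynamics (d : GameData) (P : Measure Ω) (F : Filtration ℝ≥0 m)
    (W : ℝ≥0 → Ω → ℝ) : Prop :=
  ∀ x ∈ d.O, ∃ X : ℝ≥0 → Ω → ℝ, IsSolution d P F W x (fun _ _ => 0) X d.T.toNNReal ∧
    ∀ᵐ ω ∂P, ∀ s ≤ d.T.toNNReal, X s ω ∈ d.O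

/-- A pair `ν⁺, ν⁻` of adapted, non-decreasing, right-continuous processes with `ν^±_{0-} = 0`
(so `ν^±_0 ≥ 0` is the size of a possible jump at time `0`). -/
structure SingularControl (F : Filtration ℝ≥0 m) where
  up : ℝ≥0 → Ω → ℝ
  down : ℝ≥0 → Ω → ℝ
  adapted_up : Adapted F up
  adapted_down : Adapted F down
  mono_up : ∀ ω, Monotone fun s => up s ω
  mono_down : ∀ ω, Monotone fun s => down s ω
  rightCont_up : ∀ ω s, ContinuousWithinAt (fun u => up u ω) (Ici s) s
  rightCont_down : ∀ ω s, ContinuousWithinAt (fun u => down u ω) (Ici s) s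
  nonneg_up : ∀ ω, 0 ≤ up 0 ω
  nonneg_down : ∀ ω, 0 ≤ down 0 ω

namespace SingularControl

variable {F : Filtration ℝ≥0 m}

/-- The control `ν = ν⁺ - ν⁻`. -/
def process (c : SingularControl F) (s : ℝ≥0) (ω : Ω) : ℝ := c.up s ω - c.down s ω

/-- A path of `ν`, set to `0` on `(-∞,0)` and frozen after time `S`. -/
def path (c : SingularControl F) (S : ℝ≥0) (ω : Ω) (s : ℝ) : ℝ :=
  if s < 0 then 0 else c.process (min s.toNNReal S) ω

theorem monotone_extension {f : ℝ≥0 → ℝ} (hf : Monotone f) (h0 : 0 ≤ f 0) (S : ℝ≥0) :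
    Monotone fun s : ℝ => if s < 0 then 0 else f (min s.toNNReal S) := by
  intro a b hab
  dsimp only
  split_ifs with h1 h2
  · exact le_rfl
  · exact h0.trans (hf (zero_le))
  · linarith
  · exact hf (min_le_min_right _ (Real.toNNReal_le_toNNReal hab))

theorem boundedVariation_extension {f : ℝ≥0 → ℝ} (hf : Monotone f) (h0 : 0 ≤ f 0) (S : ℝ≥0) :
    BoundedVariationOn (fun s : ℝ => if s < 0 then 0 else f (min s.toNNReal S)) univ := by
  apply ((monotone_extension hf h0 S).monotoneOn univ).boundedVariationOn (C := f S)
  intro s _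
  have hS : 0 ≤ f S := h0.trans (hf (zero_le))
  split_ifs with h
  · simpa using hS
  · rw [abs_of_nonneg (h0.trans (hf (zero_le)))]
    exact hf (min_le_right _ _)

theorem boundedVariationOn_sub {f g : ℝ → ℝ} (hf : BoundedVariationOn f univ)
    (hg : BoundedVariationOn g univ) : BoundedVariationOn (fun s => f s - g s) univ := by
  refine ne_top_of_le_ne_top (ENNReal.add_ne_top.2 ⟨hf, hg⟩) (iSup_le ?_)
  rintro ⟨n, u, hu, hmem⟩
  calc ∑ i ∈ Finset.range n, edist (f (u (i + 1)) - g (u (i + 1))) (f (u i) - g (u i))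
      ≤ ∑ i ∈ Finset.range n,
          (edist (f (u (i + 1))) (f (u i)) + edist (g (u (i + 1))) (g (u i))) := by
        refine Finset.sum_le_sum fun i _ => ?_
        simpa only [sub_eq_add_neg, edist_neg_neg] using
          edist_add_add_le (f (u (i + 1))) (-g (u (i + 1))) (f (u i)) (-g (u i))
    _ ≤ _ := by
        rw [Finset.sum_add_distrib]
        exact add_le_add (eVariationOn.sum_le hu hmem) (eVariationOn.sum_le hu hmem)

theorem boundedVariationOn_path (c : SingularControl F) (S : ℝ≥0) (ω : Ω) :
    BoundedVariationOn (c.path S ω) univ := by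
  have h := boundedVariationOn_sub
    (boundedVariation_extension (c.mono_up ω) (c.nonneg_up ω) S)
    (boundedVariation_extension (c.mono_down ω) (c.nonneg_down ω) S)
  convert h using 1
  funext s
  simp only [path, process]
  split_ifs <;> simp

/-- The total variation measure `d|ν|` of a path of `ν` on `[0,S]`; it charges `{0}` with
`|ν_0|`. -/
def totalVariation (c : SingularControl F) (S : ℝ≥0) (ω : Ω) : Measure ℝ :=
  (c.boundedVariationOn_path S ω).vectorMeasure.variation

end SingularControl

/-! ### The game -/

/-- First exit time from `O` on `[0,S]`, with `inf ∅ = S`. -/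
def exitTime (O : Set ℝ) (S : ℝ≥0) (X : ℝ≥0 → Ω → ℝ) (ω : Ω) : ℝ≥0 :=
  sInf ({s | s ≤ S ∧ X s ω ∉ O} ∪ {S})

/-- `c` is an admissible control for the initial condition `(t,x)` and `X` is the corresponding
controlled process `X^ν`. When `O = ℝ` the last two conditions hold automatically. -/
structure IsAdmissible (d : GameData) (P : Measure Ω) (F : Filtration ℝ≥0 m)
    (W : ℝ≥0 → Ω → ℝ) (t x : ℝ) (c : SingularControl F) (X : ℝ≥0 → Ω → ℝ) : Prop where
  solution : IsSolution d P F W x c.process X (d.horizon t)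
  sq_up : MemLp (c.up (d.horizon t)) 2 P
  sq_down : MemLp (c.down (d.horizon t)) 2 P
  state : ∀ᵐ ω ∂P, ∀ s ≤ d.horizon t, X s ω ∈ closure d.O
  absorbed : ∀ᵐ ω ∂P, ∀ s ≤ d.horizon t, exitTime d.O (d.horizon t) X ω ≤ s →
    c.up s ω = c.up (exitTime d.O (d.horizon t) X ω) ω ∧
    c.down s ω = c.down (exitTime d.O (d.horizon t) X ω) ω

/-- The admissible controls for `(t,x)`, each together with its controlled process. -/
def Controls (d : GameData) (P : Measure Ω) (F : Filtration ℝ≥0 m) (W : ℝ≥0 → Ω → ℝ)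
    (t x : ℝ) : Type _ :=
  {cX : SingularControl F × (ℝ≥0 → Ω → ℝ) // IsAdmissible d P F W t x cX.1 cX.2}

/-- The stopping times of the filtration with values in `[0,T-t]` almost surely. -/
def StoppingTimes (d : GameData) (P : Measure Ω) (F : Filtration ℝ≥0 m) (t : ℝ) : Type _ :=
  {τ : Ω → ℝ≥0 // IsStoppingTime F (fun ω => (τ ω : WithTop ℝ≥0)) ∧
    ∀ᵐ ω ∂P, τ ω ≤ d.horizon t}

/-- The expectation `E[Z⁺] - E[Z⁻]` with values in `[-∞,∞]`. -/
def expectation (P : Measure Ω) (Z : Ω → ℝ) : EReal :=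
  ((∫⁻ ω, ENNReal.ofReal (Z ω) ∂P : ℝ≥0∞) : EReal) -
    ((∫⁻ ω, ENNReal.ofReal (-Z ω) ∂P : ℝ≥0∞) : EReal)

/-- The random payoff when the game is stopped at time `u` (not later than the exit from `O`). -/
def payoff (d : GameData) {F : Filtration ℝ≥0 m} (t : ℝ) (c : SingularControl F)
    (X : ℝ≥0 → Ω → ℝ) (u : ℝ≥0) (ω : Ω) : ℝ :=
  Real.exp (-d.r * u) * d.g (t + u)
    + (∫ s in (0 : ℝ)..u, Real.exp (-d.r * s) * d.h (t + s) (X s.toNNReal ω))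
    + ∫ s in Icc (0 : ℝ) u, Real.exp (-d.r * s) * d.α₀ ∂(c.totalVariation (d.horizon t) ω)

/-- The expected payoff `J_{t,x}(τ,ν)`. -/
def expectedPayoff (d : GameData) (P : Measure Ω) (F : Filtration ℝ≥0 m) (W : ℝ≥0 → Ω → ℝ)
    (t x : ℝ) (τ : StoppingTimes d P F t) (ν : Controls d P F W t x) : EReal :=
  expectation P fun ω =>
    payoff d t ν.1.1 ν.1.2 (min (τ.1 ω) (exitTime d.O (d.horizon t) ν.1.2 ω)) ω

/-- The upper value `inf_ν sup_τ J_{t,x}(τ,ν)`. -/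
def upperValue (d : GameData) (P : Measure Ω) (F : Filtration ℝ≥0 m) (W : ℝ≥0 → Ω → ℝ)
    (t x : ℝ) : EReal :=
  ⨅ ν : Controls d P F W t x, ⨆ τ : StoppingTimes d P F t, expectedPayoff d P F W t x τ ν

/-- The lower value `sup_τ inf_ν J_{t,x}(τ,ν)`. -/
def lowerValue (d : GameData) (P : Measure Ω) (F : Filtration ℝ≥0 m) (W : ℝ≥0 → Ω → ℝ)
    (t x : ℝ) : EReal :=
  ⨆ τ : StoppingTimes d P F t, ⨅ ν : Controls d P F W t x, expectedPayoff d P F W t x τ ν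

/-- The (real-valued) function `v` is the value of the game on `[0,T] × O`. -/
def IsValue (d : GameData) (P : Measure Ω) (F : Filtration ℝ≥0 m) (W : ℝ≥0 → Ω → ℝ)
    (v : ℝ → ℝ → ℝ) : Prop :=
  ∀ t ∈ Icc 0 d.T, ∀ x ∈ d.O,
    upperValue d P F W t x = (v t x : EReal) ∧ lowerValue d P F W t x = (v t x : EReal)

end

end StopperGame

/-! Fix x ≤ y and a control ν for (t,y) with state X. Starting from x, the minimiser does at least
as well with one control that works against every stopping time: let the uncontrolled state Z run
from x until X − Z crosses zero, at a time ρ; at ρ jump from Z to X; afterwards copy ν. Call the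
resulting state Y. Before ρ one has Z < X, so Y ≤ X throughout, and the running cost is no larger
because h is non-decreasing in space. X and Y leave O at the same time, because Z stays in O and O
is upward closed.

It remains to pay for the jump. D = X − Z equals y − x plus a continuous path plus ν, so D and ν
have the same jumps, and D_{ρ-} ≥ 0. If D_ρ ≤ 0, then Δν_ρ ≤ D_ρ ≤ 0; if D_ρ > 0, then D_{ρ-} = 0
and D_ρ = Δν_ρ. Either way |D_ρ| ≤ |Δν_ρ| (`crossingTime_jump`), and the variation measure of the
new control is dominated by that of ν (`variation_restart_le`). No comparison theorem for the
diffusion is involved.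

Here ρ is the first time the running infimum of D is at most zero. This also catches a zero left
limit followed by an upward jump, and countably many values of D up to s decide whether ρ has
occurred by s, so the usual conditions on the filtration are not needed (`measurableSet_crossed`).

That Y solves the equation requires splicing two Itô integrals. In the Riemann sums the switch
affects only the partition interval around ρ; there the integrands differ by at most K|D|, which is
multiplied by a small increment of W (`exists_modulus`, `IsItoIntegral.ite_crossed`). -/

namespace StopperGame

/-! ### Right-continuous and càdlàg paths -/

/-- A path that is right-continuous with finite left limits. -/
def CadlagPath (f : ℝ≥0 → ℝ) : Prop :=
  ∀ s : ℝ≥0, ContinuousWithinAt f (Ici s) s ∧ ∃ l : ℝ, Tendsto f (𝓝[<] s) (𝓝 l)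

theorem CadlagPath.sub {f g : ℝ≥0 → ℝ} (hf : CadlagPath f) (hg : CadlagPath g) :
    CadlagPath fun s => f s - g s := fun s => by
  obtain ⟨l, hl⟩ := (hf s).2
  obtain ⟨k, hk⟩ := (hg s).2
  exact ⟨(hf s).1.sub (hg s).1, l - k, hl.sub hk⟩

theorem CadlagPath.const_mul {f : ℝ≥0 → ℝ} (hf : CadlagPath f) (K : ℝ) :
    CadlagPath fun s => K * f s := fun s => by
  obtain ⟨l, hl⟩ := (hf s).2
  exact ⟨continuousWithinAt_const.mul (hf s).1, K * l, hl.const_mul K⟩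

/-- Near each point the value and the left limit bound the path on the two sides; compactness of
`[0,S]` combines finitely many such bounds. -/
theorem CadlagPath.exists_bound {f : ℝ≥0 → ℝ} (hf : CadlagPath f) (S : ℝ≥0) :
    ∃ C : ℝ, ∀ s ≤ S, |f s| ≤ C := by
  have key : ∃ C : ℝ, ∀ s ∈ Icc 0 S, |f s| ≤ C := by
    refine isCompact_Icc.induction_on (p := fun A => ∃ C : ℝ, ∀ s ∈ A, |f s| ≤ C)
      ⟨0, by simp⟩ ?_ ?_ ?_
    · rintro A B hAB ⟨C, hC⟩
      exact ⟨C, fun s hs => hC s (hAB hs)⟩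
    · rintro A B ⟨C, hC⟩ ⟨C', hC'⟩
      refine ⟨max C C', fun s hs => hs.elim (fun h => (hC s h).trans (le_max_left _ _))
        fun h => (hC' s h).trans (le_max_right _ _)⟩
    · intro s _
      obtain ⟨l, hl⟩ := (hf s).2
      have h1 : ∀ᶠ u in 𝓝[≥] s, |f u| ≤ |f s| + 1 :=
        ((hf s).1.tendsto.abs).eventually (eventually_le_nhds (by linarith))
      have h2 : ∀ᶠ u in 𝓝[<] s, |f u| ≤ |l| + 1 :=
        hl.abs.eventually (eventually_le_nhds (by linarith))
      have h3 : ∀ᶠ u in 𝓝 s, |f u| ≤ max (|f s| + 1) (|l| + 1) := by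
        rw [← nhdsLT_sup_nhdsGE, eventually_sup]
        exact ⟨h2.mono fun u hu => hu.trans (le_max_right _ _),
          h1.mono fun u hu => hu.trans (le_max_left _ _)⟩
      exact ⟨_, mem_nhdsWithin_of_mem_nhds h3, _, fun u hu => hu⟩
  obtain ⟨C, hC⟩ := key
  exact ⟨C, fun s hs => hC s ⟨zero_le, hs⟩⟩

/-- The points `(⌊(n+1) s⌋ + 1) / (n+1)` decrease to `s`. -/
theorem tendsto_floor_succ_div (s : ℝ≥0) :
    Tendsto (fun n : ℕ => ((⌊((n : ℝ≥0) + 1) * s⌋₊ : ℝ≥0) + 1) / ((n : ℝ≥0) + 1)) atTop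
      (𝓝[≥] s) := by
  refine tendsto_nhdsWithin_iff.2 ⟨?_, Eventually.of_forall fun n => ?_⟩
  · have h0 : Tendsto (fun n : ℕ => s + 1 / ((n : ℝ≥0) + 1)) atTop (𝓝 s) := by
      simpa using (tendsto_const_nhds (x := s)).add
        (tendsto_one_div_add_atTop_nhds_zero_nat (𝕜 := ℝ≥0))
    refine tendsto_of_tendsto_of_tendsto_of_le_of_le tendsto_const_nhds h0 (fun n => ?_)
      fun n => ?_
    · dsimp only
      rw [le_div_iff₀ (by positivity), mul_comm]
      exact (Nat.lt_floor_add_one _).le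
    · dsimp only
      have h1 : (s + 1 / ((n : ℝ≥0) + 1)) * ((n : ℝ≥0) + 1) = ((n : ℝ≥0) + 1) * s + 1 := by
        field_simp
      rw [div_le_iff₀ (by positivity), h1]
      gcongr
      exact Nat.floor_le zero_le
  · rw [mem_Ici, le_div_iff₀ (by positivity), mul_comm]
    exact (Nat.lt_floor_add_one _).le

/-- Sampling at grid points that decrease to `s` gives step functions factoring through ℕ;
right-continuity makes them converge pointwise. -/
theorem measurable_of_rightContinuous {f : ℝ≥0 → ℝ}
    (hf : ∀ s, ContinuousWithinAt f (Ici s) s) : Measurable f := by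
  refine measurable_of_tendsto_metrizable
    (f := fun n s => f (((⌊((n : ℝ≥0) + 1) * s⌋₊ : ℝ≥0) + 1) / ((n : ℝ≥0) + 1))) (fun n => ?_)
    (tendsto_pi_nhds.2 fun s => (hf s).tendsto.comp (tendsto_floor_succ_div s))
  exact (measurable_from_nat (f := fun k => f (((k : ℝ≥0) + 1) / ((n : ℝ≥0) + 1)))).comp
    (Nat.measurable_floor.comp (measurable_const_mul _))

theorem intervalIntegrable_of_rightContinuous {f : ℝ≥0 → ℝ} {S : ℝ≥0}
    (hf : ∀ s < S, ContinuousWithinAt f (Ici s) s) {C : ℝ} (hC : ∀ s < S, |f s| ≤ C) :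
    IntervalIntegrable (fun s : ℝ => f s.toNNReal) volume 0 S := by
  -- Cutting to zero on `[S,∞)` keeps right-continuity everywhere, including at `S`, so nothing is
  -- asked of `f` from `S` on.
  have hg : ∀ s, ContinuousWithinAt (fun s => if s < S then f s else 0) (Ici s) s := by
    intro s
    by_cases hs : s < S
    · refine (hf s hs).congr_of_eventuallyEq ?_ (by simp [hs])
      filter_upwards [mem_nhdsWithin_of_mem_nhds (Iio_mem_nhds hs)] with u hu
      simp [mem_Iio.1 hu]
    · refine (continuousWithinAt_const (b := (0 : ℝ))).congr (fun u hu => ?_) (by simp [hs])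
      simp [not_lt.2 ((not_lt.1 hs).trans hu)]
  have hm := (measurable_of_rightContinuous hg).comp measurable_real_toNNReal
  rw [intervalIntegrable_iff_integrableOn_Ioo_of_le NNReal.zero_le_coe]
  have hgi : IntegrableOn ((fun s => if s < S then f s else 0) ∘ Real.toNNReal) (Ioo 0 (S : ℝ)) :=
    Measure.integrableOn_of_bounded (M := |C|) (by simp) hm.aestronglyMeasurable
      (ae_of_all _ fun s => by
        simp only [Function.comp, Real.norm_eq_abs]
        split_ifs with h
        · exact (hC _ h).trans (le_abs_self C)
        · simp)
  refine hgi.congr_fun (fun s hs => ?_) measurableSet_Ioo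
  have : s.toNNReal < S := (Real.toNNReal_lt_iff_lt_coe hs.1.le).2 hs.2
  simp [this]

/-! ### The first time at which a path comes close to the non-positive half-line -/

/-- The infimum of `D` over `[0,s]` is at most zero. -/
def Crossed (D : ℝ≥0 → ℝ) (s : ℝ≥0) : Prop := ∀ ε : ℝ, 0 < ε → ∃ u ≤ s, D u < ε

/-- The first time at which the running infimum of `D` is at most zero. -/
noncomputable def crossingTime (D : ℝ≥0 → ℝ) : ℝ≥0 := sInf {s | Crossed D s}

section Crossed

variable {D : ℝ≥0 → ℝ} {s u : ℝ≥0}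

theorem Crossed.mono (h : Crossed D s) (hsu : s ≤ u) : Crossed D u := fun ε hε => by
  obtain ⟨v, hv, hD⟩ := h ε hε
  exact ⟨v, hv.trans hsu, hD⟩

theorem exists_le_of_not_crossed (h : ¬ Crossed D s) : ∃ ε : ℝ, 0 < ε ∧ ∀ u ≤ s, ε ≤ D u := by
  simpa only [Crossed, not_forall, not_exists, not_and, not_lt, exists_prop] using h

theorem pos_of_not_crossed (h : ¬ Crossed D s) : 0 < D s := by
  obtain ⟨ε, hε, hD⟩ := exists_le_of_not_crossed h
  exact hε.trans_le (hD s le_rfl)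

theorem crossed_of_nonpos (h : D s ≤ 0) : Crossed D s := fun _ hε => ⟨s, le_rfl, h.trans_lt hε⟩

theorem Crossed.crossingTime_le (h : Crossed D s) : crossingTime D ≤ s :=
  csInf_le (OrderBot.bddBelow _) h

/-- A positive lower bound on `[0,s]` survives, halved, slightly beyond `s` by right-continuity.
Hence the crossed times form a half-line that contains its left end-point. -/
theorem eventually_not_crossed (hD : ContinuousWithinAt D (Ici s) s) (h : ¬ Crossed D s) :
    ∀ᶠ u in 𝓝[≥] s, ¬ Crossed D u := by
  obtain ⟨ε, hε, hb⟩ := exists_le_of_not_crossed h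
  have h1 : ∀ᶠ u in 𝓝[≥] s, ε / 2 < D u :=
    hD.tendsto.eventually (lt_mem_nhds (by linarith [hb s le_rfl]))
  obtain ⟨v, hv, hIco⟩ := mem_nhdsGE_iff_exists_Ico_subset.1 h1
  filter_upwards [Ico_mem_nhdsGE hv] with u hu hc
  obtain ⟨w, hw, hlt⟩ := hc (ε / 2) (by linarith)
  rcases le_total w s with h2 | h2
  · linarith [hb w h2]
  · exact absurd (hIco ⟨h2, hw.trans_lt hu.2⟩) (not_lt.2 hlt.le)

theorem Crossed.crossed_crossingTime (hD : ∀ s, ContinuousWithinAt D (Ici s) s)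
    (h : Crossed D s) : Crossed D (crossingTime D) := by
  by_contra hc
  obtain ⟨v, hv, hIco⟩ := mem_nhdsGE_iff_exists_Ico_subset.1 (eventually_not_crossed (hD _) hc)
  obtain ⟨w, hw, hlt⟩ := exists_lt_of_csInf_lt (s := {s | Crossed D s}) ⟨s, h⟩ hv
  exact hIco ⟨Crossed.crossingTime_le hw, hlt⟩ hw

/-- Some crossed time must be given: if there is none, `crossingTime` is `sInf ∅ = 0` and the
equivalence fails. -/
theorem Crossed.crossed_iff (hD : ∀ s, ContinuousWithinAt D (Ici s) s) (h : Crossed D s) :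
    Crossed D u ↔ crossingTime D ≤ u :=
  ⟨Crossed.crossingTime_le, (h.crossed_crossingTime hD).mono⟩

theorem not_crossed_of_lt (h : s < crossingTime D) : ¬ Crossed D s :=
  fun hc => absurd hc.crossingTime_le (not_le.2 h)

-- Either status persists immediately to the right of `s`, and immediately to the left the status is
-- constant as well, so on each side the spliced path coincides with one of the two.
open Classical in
theorem cadlagPath_ite_crossed {f g : ℝ≥0 → ℝ} (hD : ∀ s, ContinuousWithinAt D (Ici s) s)
    (hf : CadlagPath f) (hg : CadlagPath g) :
    CadlagPath fun s => if Crossed D s then f s else g s := by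
  intro s
  constructor
  · by_cases hs : Crossed D s
    · refine (hf s).1.congr (fun u hu => ?_) (by simp [hs])
      simp [hs.mono hu]
    · refine (hg s).1.congr_of_eventuallyEq ?_ (by simp [hs])
      filter_upwards [eventually_not_crossed (hD s) hs] with u hu
      simp [hu]
  · by_cases hs : ∃ u < s, Crossed D u
    · obtain ⟨u, hu, hc⟩ := hs
      obtain ⟨l, hl⟩ := (hf s).2
      refine ⟨l, hl.congr' ?_⟩
      filter_upwards [Ioo_mem_nhdsLT hu] with v hv
      simp [hc.mono hv.1.le]
    · obtain ⟨l, hl⟩ := (hg s).2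
      refine ⟨l, hl.congr' ?_⟩
      filter_upwards [self_mem_nhdsWithin] with v hv
      have : ¬ Crossed D v := fun h => hs ⟨v, hv, h⟩
      simp [this]

end Crossed

/-! ### Adaptedness -/

section Adapted

variable {Ω : Type*} {m : MeasurableSpace Ω} {F : Filtration ℝ≥0 m} {D A : ℝ≥0 → Ω → ℝ}

/-- An open condition at `u` is also met at a term of a fixed countable dense set just to the right;
this turns uncountable unions over times into countable ones. -/
theorem exists_denseSeq_between {f : ℝ≥0 → ℝ} {u c : ℝ≥0}
    (hf : ContinuousWithinAt f (Ici u) u) (huc : u < c) {U : Set ℝ} (hU : IsOpen U)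
    (hu : f u ∈ U) :
    ∃ n : ℕ, u < TopologicalSpace.denseSeq ℝ≥0 n ∧ TopologicalSpace.denseSeq ℝ≥0 n < c ∧
      f (TopologicalSpace.denseSeq ℝ≥0 n) ∈ U := by
  have h1 : ∀ᶠ v in 𝓝[≥] u, f v ∈ U := hf.tendsto.eventually (hU.mem_nhds hu)
  obtain ⟨v, hv, hIco⟩ := mem_nhdsGE_iff_exists_Ico_subset.1 h1
  obtain ⟨_, ⟨n, rfl⟩, hn⟩ :=
    (TopologicalSpace.denseRange_denseSeq ℝ≥0).exists_between (lt_min huc hv)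
  exact ⟨n, hn.1, hn.2.trans_le (min_le_left _ _),
    hIco ⟨hn.1.le, hn.2.trans_le (min_le_right _ _)⟩⟩

/-- The end-point `s` is listed separately: dense times approximating it from the right would lie
outside the information `F s`. -/
theorem measurableSet_crossed (hD : Adapted F D)
    (hr : ∀ ω s, ContinuousWithinAt (fun u => D u ω) (Ici s) s) (s : ℝ≥0) :
    MeasurableSet[F s] {ω | Crossed (fun u => D u ω) s} := by
  have : {ω | Crossed (fun u => D u ω) s} = ⋂ k : ℕ, ({ω | D s ω < 1 / ((k : ℝ) + 1)} ∪
      ⋃ n : ℕ, {ω | TopologicalSpace.denseSeq ℝ≥0 n ≤ s ∧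
        D (TopologicalSpace.denseSeq ℝ≥0 n) ω < 1 / ((k : ℝ) + 1)}) := by
    ext ω
    simp only [mem_iInter, mem_union, mem_iUnion, mem_ofPred_eq]
    constructor
    · intro h k
      obtain ⟨u, hu, hlt⟩ := h (1 / ((k : ℝ) + 1)) (by positivity)
      rcases hu.eq_or_lt with rfl | hus
      · exact Or.inl hlt
      · obtain ⟨n, -, h2, h3⟩ := exists_denseSeq_between (hr ω u) hus isOpen_Iio hlt
        exact Or.inr ⟨n, h2.le, h3⟩
    · intro h ε hε
      obtain ⟨k, hk⟩ := exists_nat_one_div_lt hε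
      rcases h k with h1 | ⟨n, hn, h1⟩
      · exact ⟨s, le_rfl, h1.trans hk⟩
      · exact ⟨_, hn, h1.trans hk⟩
  rw [this]
  refine MeasurableSet.iInter fun k => MeasurableSet.union (hD s measurableSet_Iio)
    (MeasurableSet.iUnion fun n => ?_)
  by_cases hn : TopologicalSpace.denseSeq ℝ≥0 n ≤ s
  · have h1 : MeasurableSet[F s] {ω | D (TopologicalSpace.denseSeq ℝ≥0 n) ω < 1 / ((k : ℝ) + 1)} :=
      F.mono hn _ (hD (TopologicalSpace.denseSeq ℝ≥0 n) measurableSet_Iio)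
    simpa only [hn, true_and] using h1
  · simp [hn]

/-! ### Evaluation of a process at a random time -/

theorem measurable_eval_nat {Ω : Type*} [MeasurableSpace Ω] {g : ℕ → Ω → ℝ}
    (hg : ∀ k, Measurable (g k)) {N : Ω → ℕ} (hN : Measurable N) :
    Measurable fun ω => g (N ω) ω :=
  (measurable_from_prod_countable_right (f := fun p : ℕ × Ω => g p.1 p.2) hg).comp
    (hN.prodMk measurable_id)

/-- `R` is discretised from above and capped at `s`; since `R ≤ s`, the capped times still approach
`R` from the right, and only `A u` with `u ≤ s` is used. -/
theorem measurable_eval_of_rightContinuous {Ω : Type*} [MeasurableSpace Ω] {A : ℝ≥0 → Ω → ℝ}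
    {R : Ω → ℝ≥0} {s : ℝ≥0} (hR : Measurable R) (hRs : ∀ ω, R ω ≤ s)
    (hA : ∀ u ≤ s, Measurable (A u))
    (hAr : ∀ ω s, ContinuousWithinAt (fun u => A u ω) (Ici s) s) :
    Measurable fun ω => A (R ω) ω := by
  refine measurable_of_tendsto_metrizable
    (f := fun n ω => A (min (((⌊((n : ℝ≥0) + 1) * R ω⌋₊ : ℝ≥0) + 1) / ((n : ℝ≥0) + 1)) s) ω)
    (fun n => ?_) (tendsto_pi_nhds.2 fun ω => ?_)
  · have h2 : Measurable fun ω => ⌊((n : ℝ≥0) + 1) * R ω⌋₊ :=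
      Nat.measurable_floor.comp (hR.const_mul _)
    exact measurable_eval_nat (g := fun k => A (min (((k : ℝ≥0) + 1) / ((n : ℝ≥0) + 1)) s))
      (fun k => hA _ (min_le_right _ _)) h2
  · have h1 : Tendsto (fun n : ℕ =>
        min (((⌊((n : ℝ≥0) + 1) * R ω⌋₊ : ℝ≥0) + 1) / ((n : ℝ≥0) + 1)) s) atTop (𝓝[≥] (R ω)) := by
      obtain ⟨h2, h3⟩ := tendsto_nhdsWithin_iff.1 (tendsto_floor_succ_div (R ω))
      refine tendsto_nhdsWithin_iff.2 ⟨?_, h3.mono fun n hn => le_min hn (hRs ω)⟩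
      simpa [min_eq_left (hRs ω)] using h2.min (tendsto_const_nhds (x := s))
    exact (hAr ω (R ω)).tendsto.comp h1

open Classical in
theorem measurable_ite_crossed_crossingTime (hD : Adapted F D)
    (hr : ∀ ω s, ContinuousWithinAt (fun u => D u ω) (Ici s) s) (hA : Adapted F A)
    (hAr : ∀ ω s, ContinuousWithinAt (fun u => A u ω) (Ici s) s) (s : ℝ≥0) :
    Measurable[F s] fun ω =>
      if Crossed (fun u => D u ω) s then A (crossingTime fun u => D u ω) ω else 0 := by
  have hC := measurableSet_crossed hD hr s
  -- The default 0 off the crossed event keeps `R ≤ s`; there the value is discarded by the outer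
  -- `if`.
  set R : Ω → ℝ≥0 := fun ω =>
    if Crossed (fun u => D u ω) s then crossingTime (fun u => D u ω) else 0 with hR
  have hRs : ∀ ω, R ω ≤ s := by
    intro ω
    simp only [hR]
    split_ifs with h
    · exact h.crossingTime_le
    · exact zero_le
  have hRm : Measurable[F s] R := by
    refine @measurable_of_Iic ℝ≥0 Ω _ _ _ (F s) _ _ _ R fun a => ?_
    rcases le_total s a with h | h
    · have : R ⁻¹' Iic a = univ := eq_univ_of_forall fun ω => (hRs ω).trans h
      rw [this]
      exact MeasurableSet.univ
    · have : R ⁻¹' Iic a = {ω | Crossed (fun u => D u ω) s}ᶜ ∪ {ω | Crossed (fun u => D u ω) a} := by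
        ext ω
        simp only [hR, mem_preimage, mem_Iic, mem_union, mem_compl_iff, mem_ofPred_eq]
        by_cases hc : Crossed (fun u => D u ω) s
        · simp [hc, hc.crossed_iff (hr ω)]
        · simp [hc]
      rw [this]
      exact hC.compl.union (F.mono h _ (measurableSet_crossed hD hr a))
  have hAR : Measurable[F s] fun ω => A (R ω) ω :=
    @measurable_eval_of_rightContinuous Ω (F s) A R s hRm hRs
      (fun u hu => (hA u).mono (F.mono hu) le_rfl) hAr
  have h : Measurable[F s] fun ω => if Crossed (fun u => D u ω) s then A (R ω) ω else 0 :=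
    Measurable.ite hC hAR measurable_const
  refine (congrArg (Measurable[F s]) (funext fun ω => ?_)).mp h
  by_cases hc : Crossed (fun u => D u ω) s <;> simp [hR, hc]

end Adapted

/-! ### Variation of a path that is restarted with a smaller jump -/

theorem isFiniteMeasure_variation_signedMeasure {X : Type*} {mX : MeasurableSpace X}
    (v : SignedMeasure X) : IsFiniteMeasure (VectorMeasure.variation v) := by
  rw [← SignedMeasure.totalVariation_eq_variation, SignedMeasure.totalVariation]
  infer_instance

/-- `b` vanishes before `ρ`, jumps there by `J`, and then has the increments of `a`. Agreement on
half-open intervals and on total mass determines the measure. -/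
theorem vectorMeasure_eq_restrict_add_dirac {a b : ℝ → ℝ} (ha : BoundedVariationOn a univ)
    (hb : BoundedVariationOn b univ) (har : ∀ s, ContinuousWithinAt a (Ici s) s) {ρ J : ℝ}
    (hba : ∀ s, b s = if s < ρ then 0 else J + (a s - a ρ)) :
    hb.vectorMeasure = ha.vectorMeasure.restrict (Ioi ρ) + VectorMeasure.dirac ρ J := by
  have hbr : ∀ s, ContinuousWithinAt b (Ici s) s := by
    intro s
    by_cases hs : s < ρ
    · refine (continuousWithinAt_const (b := (0 : ℝ))).congr_of_eventuallyEq ?_ (by simp [hba, hs])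
      filter_upwards [mem_nhdsWithin_of_mem_nhds (Iio_mem_nhds hs)] with u hu
      simp [hba, mem_Iio.1 hu]
    · refine ((continuousWithinAt_const (b := J)).add
        ((har s).sub (continuousWithinAt_const (b := a ρ)))).congr (fun u hu => ?_) ?_
      · simp [hba, not_lt.2 ((not_lt.1 hs).trans hu)]
      · simp [hba, hs]
  have hA : ∀ s, a.rightLim s = a s := fun s => (har s).rightLim_eq
  have hB : ∀ s, b.rightLim s = b s := fun s => (hbr s).rightLim_eq
  refine VectorMeasure.ext_of_generateFrom {s | ∃ l u : ℝ, l < u ∧ Ioc l u = s} ?_ ?_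
    (by simpa using isPiSystem_Ioc (id : ℝ → ℝ) id) ?_
  · rintro _ ⟨l, u, hlu, rfl⟩
    rw [hb.vectorMeasure_Ioc hlu.le, _root_.add_apply,
      VectorMeasure.restrict_apply _ measurableSet_Ioi measurableSet_Ioc, hB, hB, hba, hba]
    by_cases hu : u < ρ
    · have h1 : Ioc l u ∩ Ioi ρ = ∅ := by
        ext z; simp only [mem_inter_iff, mem_Ioc, mem_Ioi, mem_empty_iff_false, iff_false]
        intro h; linarith [h.1.2, h.2]
      rw [h1, VectorMeasure.dirac_apply_of_notMem (by simp [hu])]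
      simp [hu, hlu.trans hu]
    · rw [not_lt] at hu
      by_cases hl : l < ρ
      · have h1 : Ioc l u ∩ Ioi ρ = Ioc ρ u := by
          ext z; simp only [mem_inter_iff, mem_Ioc, mem_Ioi]
          constructor
          · intro h; exact ⟨h.2, h.1.2⟩
          · intro h; exact ⟨⟨hl.trans h.1, h.2⟩, h.1⟩
        rw [h1, VectorMeasure.dirac_apply_of_mem measurableSet_Ioc ⟨hl, hu⟩,
          ha.vectorMeasure_Ioc hu, hA, hA]
        simp [hl, not_lt.2 hu, add_comm]
      · rw [not_lt] at hl
        have h1 : Ioc l u ∩ Ioi ρ = Ioc l u := by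
          ext z; simp only [mem_inter_iff, mem_Ioc, mem_Ioi, and_iff_left_iff_imp]
          intro h; exact hl.trans_lt h.1
        rw [h1, VectorMeasure.dirac_apply_of_notMem (by simp [hl]), ha.vectorMeasure_Ioc hlu.le,
          hA, hA]
        simp [not_lt.2 hl, not_lt.2 hu]
  · rw [borel_eq_generateFrom_Ioc ℝ |>.symm]
    exact BorelSpace.measurable_eq
  · rw [_root_.add_apply, VectorMeasure.restrict_apply_univ, hb.vectorMeasure_univ,
      ha.vectorMeasure_Ioi, VectorMeasure.dirac_apply_of_mem MeasurableSet.univ (mem_univ _), hA]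
    have h1 : Tendsto b atTop (𝓝 (J + (limUnder atTop a - a ρ))) := by
      refine (tendsto_const_nhds.add (ha.tendsto_atTop_limUnder.sub tendsto_const_nhds)).congr' ?_
      filter_upwards [eventually_ge_atTop ρ] with s hs
      simp [hba, not_lt.2 hs]
    have h2 : Tendsto b atBot (𝓝 0) := by
      refine tendsto_const_nhds.congr' ?_
      filter_upwards [eventually_lt_atBot ρ] with s hs
      simp [hba, hs]
    rw [h1.limUnder_eq, h2.limUnder_eq]
    ring

/-- The measure of `a` has the atom `a ρ - l` at `ρ`, at least as large as the new atom `J`, and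
beyond `ρ` the measures agree. A measure that bounds the absolute value of a vector measure on every
measurable set bounds its variation. -/
theorem variation_restart_le {a b : ℝ → ℝ} (ha : BoundedVariationOn a univ)
    (hb : BoundedVariationOn b univ) (har : ∀ s, ContinuousWithinAt a (Ici s) s) {ρ J l : ℝ}
    (hba : ∀ s, b s = if s < ρ then 0 else J + (a s - a ρ))
    (hl : Tendsto a (𝓝[<] ρ) (𝓝 l)) (hJ : |J| ≤ |a ρ - l|) :
    hb.vectorMeasure.variation ≤ ha.vectorMeasure.variation := by
  rw [vectorMeasure_eq_restrict_add_dirac ha hb har hba]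
  refine VectorMeasure.variation_le_of_forall_enorm_le fun E hE => ?_
  rw [_root_.add_apply, VectorMeasure.restrict_apply _ measurableSet_Ioi hE]
  -- Applied with `s = {ρ}` when `ρ ∈ E`, and with `s = ∅` otherwise.
  have hle : ∀ s, MeasurableSet s → s ⊆ E ∩ Iic ρ →
      ‖ha.vectorMeasure (E ∩ Ioi ρ)‖ₑ + ‖ha.vectorMeasure s‖ₑ ≤ ha.vectorMeasure.variation E := by
    intro s hs hsub
    calc _ ≤ ha.vectorMeasure.variation (E ∩ Ioi ρ) + ha.vectorMeasure.variation s :=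
          add_le_add (VectorMeasure.enorm_measure_le_variation _ _)
            (VectorMeasure.enorm_measure_le_variation _ _)
      _ = ha.vectorMeasure.variation (E ∩ Ioi ρ ∪ s) := by
          refine (measure_union ?_ hs).symm
          refine disjoint_left.2 fun z hz hz' => ?_
          exact absurd (mem_Iic.1 (hsub hz').2) (not_le.2 (mem_Ioi.1 hz.2))
      _ ≤ _ := measure_mono (union_subset inter_subset_left fun z hz => (hsub hz).1)
  by_cases hρ : ρ ∈ E
  · rw [VectorMeasure.dirac_apply_of_mem hE hρ]
    refine (enorm_add_le _ _).trans (le_trans ?_ (hle {ρ} (measurableSet_singleton ρ)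
      (by simpa using hρ)))
    gcongr
    rw [ha.vectorMeasure_singleton, (har ρ).rightLim_eq,
      leftLim_eq_of_tendsto hl, enorm_le_iff_norm_le]
    exact hJ
  · rw [VectorMeasure.dirac_apply_of_notMem hρ]
    simpa using hle ∅ MeasurableSet.empty (empty_subset _)

/-! ### The jump at the crossing time -/

/-- Extension by 0 to negative times makes the left limit at time 0 vanish, so an initial jump
counts in full. -/
theorem exists_leftLimit_extension {f : ℝ≥0 → ℝ} (hf : Monotone f) (h0 : 0 ≤ f 0) {S ρ : ℝ≥0}
    (hρ : ρ ≤ S) :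
    ∃ l : ℝ, 0 ≤ l ∧ l ≤ f ρ ∧
      Tendsto (fun s : ℝ => if s < 0 then 0 else f (min s.toNNReal S)) (𝓝[<] (ρ : ℝ)) (𝓝 l) := by
  have hm := SingularControl.monotone_extension hf h0 S
  refine ⟨_, ?_, ?_, hm.tendsto_leftLim ρ⟩
  · have h1 := hm.le_leftLim (x := (-1 : ℝ)) (y := ρ) (by linarith [NNReal.zero_le_coe (q := ρ)])
    simpa using h1
  · have h1 := hm.leftLim_le (le_refl (ρ : ℝ))
    simpa [min_eq_left hρ] using h1

/-- If `D = δ + k + a` on `[0,S]` with `δ ≥ 0` and `k` continuous, then the value of `D` at its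
crossing time is dominated by the jump of `a` there. -/
theorem crossingTime_jump {D k : ℝ≥0 → ℝ} {a : ℝ → ℝ} {S : ℝ≥0} {δ l : ℝ}
    (hDr : ∀ s, ContinuousWithinAt D (Ici s) s) (hδ : 0 ≤ δ)
    (hk : ContinuousOn k (Iic S)) (hk0 : k 0 = 0) (ha : ∀ s < 0, a s = 0)
    (hD : ∀ s ≤ S, D s = δ + k s + a s) (hc : Crossed D S)
    (hl : Tendsto a (𝓝[<] (crossingTime D : ℝ)) (𝓝 l)) :
    (D (crossingTime D) ≤ 0 → a (crossingTime D) - l ≤ D (crossingTime D)) ∧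
      (0 < D (crossingTime D) → D (crossingTime D) = a (crossingTime D) - l) := by
  have hcρ := hc.crossed_crossingTime hDr
  have hρS := hc.crossingTime_le
  have hlt : ∀ s < crossingTime D, ¬ Crossed D s := fun s hs => not_crossed_of_lt hs
  generalize crossingTime D = ρ at *
  have hDρ := hD ρ hρS
  rcases eq_or_ne ρ 0 with rfl | hρ
  · have hl0 : l = 0 := by
      refine tendsto_nhds_unique hl (tendsto_const_nhds.congr' ?_)
      filter_upwards [self_mem_nhdsWithin] with s hs
      exact (ha s (by simpa using hs)).symm
    subst hl0
    -- At `ρ = 0` the running infimum is `D 0` itself, so the second case cannot occur.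
    refine ⟨fun _ => by linarith, fun hpos => ?_⟩
    obtain ⟨u, hu, hlt'⟩ := hcρ _ hpos
    rw [nonpos_iff_eq_zero.1 hu] at hlt'
    exact absurd hlt' (lt_irrefl _)
  · have hρ0 : 0 < ρ := pos_iff_ne_zero.2 hρ
    have : (𝓝[<] ρ).NeBot := nhdsLT_neBot_of_exists_lt ⟨0, hρ0⟩
    have hcoe : Tendsto (fun s : ℝ≥0 => (s : ℝ)) (𝓝[<] ρ) (𝓝[<] (ρ : ℝ)) :=
      tendsto_nhdsWithin_iff.2 ⟨(NNReal.continuous_coe.tendsto ρ).mono_left nhdsWithin_le_nhds,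
        by filter_upwards [self_mem_nhdsWithin] with s hs using NNReal.coe_lt_coe.2 hs⟩
    have hlim : Tendsto D (𝓝[<] ρ) (𝓝 (δ + k ρ + l)) := by
      have hk' : Tendsto k (𝓝[<] ρ) (𝓝 (k ρ)) :=
        (hk ρ hρS).mono (fun s hs => (le_of_lt hs).trans hρS)
      refine ((tendsto_const_nhds.add hk').add (hl.comp hcoe)).congr' ?_
      filter_upwards [self_mem_nhdsWithin] with s hs
      exact (hD s ((le_of_lt hs).trans hρS)).symm
    have hpos : ∀ᶠ s in 𝓝[<] ρ, 0 < D s := by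
      filter_upwards [self_mem_nhdsWithin] with s hs using pos_of_not_crossed (hlt s hs)
    have hL : 0 ≤ δ + k ρ + l := ge_of_tendsto hlim (hpos.mono fun s hs => hs.le)
    refine ⟨fun _ => by linarith, fun hDpos => ?_⟩
    -- With a positive left limit and `D ρ > 0`, `D` would be bounded away from zero on `[0,ρ]`: on
    -- `[0,w]` since `w` is not crossed, on `(w,ρ)` by the limit, at `ρ` by assumption.
    have hL0 : δ + k ρ + l = 0 := by
      by_contra hne
      have hLpos : 0 < δ + k ρ + l := lt_of_le_of_ne hL (Ne.symm hne)
      obtain ⟨v, hv, hIoo⟩ := (mem_nhdsLT_iff_exists_Ioo_subset' hρ0).1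
        (hlim.eventually (lt_mem_nhds (half_lt_self hLpos)))
      obtain ⟨w, hw⟩ := exists_between (mem_Iio.1 hv)
      obtain ⟨ε, hε, hb⟩ := exists_le_of_not_crossed (hlt w hw.2)
      obtain ⟨u, hu, hDu⟩ := hcρ (min ε (min ((δ + k ρ + l) / 2) (D ρ)))
        (lt_min hε (lt_min (half_pos hLpos) hDpos))
      rcases hu.eq_or_lt with rfl | hu'
      · exact absurd (hDu.trans_le ((min_le_right _ _).trans (min_le_right _ _))) (lt_irrefl _)
      rcases le_total u w with h | h
      · exact absurd (hDu.trans_le (min_le_left _ _)) (not_lt.2 (hb u h))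
      · exact absurd (hDu.trans_le ((min_le_right _ _).trans (min_le_left _ _)))
          (not_lt.2 (le_of_lt (hIoo ⟨hw.1.trans_le h, hu'⟩)))
    linarith

/-! ### Itô integrals -/

theorem exists_isPartition (S : ℝ≥0) {δ : ℝ≥0} (hδ : 0 < δ) :
    ∃ (n : ℕ) (p : ℕ → ℝ≥0), IsPartition S δ n p := by
  refine ⟨⌈S / δ⌉₊, fun i => min (i * δ) S, ⟨?_, by simp, ?_, ?_⟩⟩
  · intro i j hij
    dsimp only
    gcongr
  · exact min_eq_right ((div_le_iff₀ hδ).1 (Nat.le_ceil _))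
  · intro i _
    push_cast
    rw [add_mul, one_mul, ← min_add_add_right]
    exact min_le_min_left _ (by simp)

theorem IsPartition.le {S δ : ℝ≥0} {n : ℕ} {p : ℕ → ℝ≥0} (hp : IsPartition S δ n p) {i : ℕ}
    (hi : i ≤ n) : p i ≤ S := hp.last ▸ hp.mono hi

theorem IsPartition.mesh_mono {S δ δ' : ℝ≥0} {n : ℕ} {p : ℕ → ℝ≥0} (hp : IsPartition S δ n p)
    (h : δ ≤ δ') : IsPartition S δ' n p :=
  ⟨hp.mono, hp.first, hp.last, fun i hi => (hp.mesh i hi).trans (by gcongr)⟩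

/-- `IsItoIntegral` on a horizon tests only partitions of that whole horizon; to restrict the
horizon, a partition is prolonged by steps `δ` capped at `T`. -/
theorem IsPartition.exists_extension {S T δ : ℝ≥0} {n : ℕ} {p : ℕ → ℝ≥0} (hδ : 0 < δ)
    (hST : S ≤ T) (hp : IsPartition S δ n p) :
    ∃ (k : ℕ) (q : ℕ → ℝ≥0), IsPartition T δ (n + k) q ∧ ∀ i ≤ n, q i = p i := by
  have hq : ∀ i ≤ n, (if i ≤ n then p i else min (S + (i - n : ℕ) * δ) T) = p i :=
    fun i hi => by simp [hi]
  have hq' : ∀ j, (if n + j ≤ n then p (n + j) else min (S + (n + j - n : ℕ) * δ) T) =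
      min (S + j * δ) T := by
    intro j
    rcases Nat.eq_zero_or_pos j with rfl | hj
    · simp [hp.last, hST]
    · simp [hj.ne']
  refine ⟨⌈(T - S) / δ⌉₊, fun i => if i ≤ n then p i else min (S + (i - n : ℕ) * δ) T,
    ⟨?_, ?_, ?_, ?_⟩, hq⟩
  · refine monotone_nat_of_le_succ fun i => ?_
    rcases lt_or_ge i n with hi | hi
    · rw [hq i hi.le, hq (i + 1) hi]
      exact hp.mono i.le_succ
    · obtain ⟨j, rfl⟩ := Nat.exists_eq_add_of_le hi
      rw [hq' j, add_assoc, hq' (j + 1)]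
      gcongr
      exact j.le_succ
  · simp [hp.first]
  · rw [hq']
    refine min_eq_right ?_
    have h1 := (div_le_iff₀ hδ).1 (Nat.le_ceil ((T - S) / δ))
    calc T = S + (T - S) := (add_tsub_cancel_of_le hST).symm
      _ ≤ _ := by gcongr
  · intro i _
    rcases lt_or_ge i n with hi | hi
    · rw [hq i hi.le, hq (i + 1) hi]
      exact hp.mesh i hi
    · obtain ⟨j, rfl⟩ := Nat.exists_eq_add_of_le hi
      rw [hq' j, add_assoc, hq' (j + 1), ← min_add_add_right]
      push_cast
      rw [add_mul, one_mul, ← add_assoc]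
      exact min_le_min_left _ (by simp)

section ItoIntegral

variable {Ω : Type*} {m : MeasurableSpace Ω} {P : Measure Ω} {H W I : ℝ≥0 → Ω → ℝ}

/-- At times `s ≤ S` the added intervals contribute nothing, since both ends are cut down to `s`. -/
theorem IsItoIntegral.restrict {S T : ℝ≥0} (hST : S ≤ T) (h : IsItoIntegral P H W I T) :
    IsItoIntegral P H W I S := by
  intro ε hε
  obtain ⟨δ, hδ, hP⟩ := h ε hε
  refine ⟨δ, hδ, fun n p hp => ?_⟩
  obtain ⟨k, q, hq, hqp⟩ := hp.exists_extension hδ hST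
  refine (measure_mono ?_).trans (hP (n + k) q hq)
  rintro ω ⟨s, hs, hle⟩
  refine ⟨s, hs.trans hST, ?_⟩
  have : riemannSum H W (n + k) q s ω = riemannSum H W n p s ω := by
    rw [riemannSum, riemannSum, Finset.sum_range_add]
    have h1 : ∀ j ∈ Finset.range k, H (q (n + j)) ω *
        (W (min (q (n + j + 1)) s) ω - W (min (q (n + j)) s) ω) = 0 := by
      intro j _
      have h2 : ∀ i, n ≤ i → min (q i) s = s := fun i hi =>
        min_eq_right (hs.trans (by rw [← hp.last, ← hqp n le_rfl]; exact hq.mono hi))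
      rw [h2 _ (by omega), h2 _ (by omega)]
      simp
    rw [Finset.sum_eq_zero h1, add_zero]
    refine Finset.sum_congr rfl fun i hi => ?_
    have hi' := Finset.mem_range.1 hi
    rw [hqp i hi'.le, hqp (i + 1) hi']
  rwa [this]

theorem continuous_riemannSum {ω : Ω} (hW : Continuous fun s => W s ω) (n : ℕ) (p : ℕ → ℝ≥0) :
    Continuous fun s => riemannSum H W n p s ω := by
  unfold riemannSum
  refine continuous_finsetSum _ fun i _ => continuous_const.mul ((hW.comp ?_).sub (hW.comp ?_)) <;>
    fun_prop

/-- Almost every path of an Itô integral is continuous and starts at zero. -/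
theorem IsItoIntegral.ae_continuousOn {S : ℝ≥0} (hW : ∀ᵐ ω ∂P, Continuous fun s => W s ω)
    (h : IsItoIntegral P H W I S) :
    ∀ᵐ ω ∂P, ContinuousOn (fun s => I s ω) (Iic S) ∧ I 0 ω = 0 := by
  choose δ hδ hP using h
  have hpos : ∀ k : ℕ, (0 : ℝ) < (1 / 2) ^ k := fun k => by positivity
  choose n p hp using fun k : ℕ => exists_isPartition S (hδ _ (hpos k))
  -- Borel–Cantelli with tolerances `2⁻ᵏ`: along suitable partitions the continuous Riemann sums
  -- converge uniformly, almost surely.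
  have hae := ae_eventually_notMem (μ := P)
    (s := fun k => {ω | ∃ s ≤ S, (1 / 2 : ℝ) ^ k ≤ |riemannSum H W (n k) (p k) s ω - I s ω|}) <| by
    refine ne_top_of_le_ne_top ?_ (ENNReal.tsum_le_tsum fun k => hP _ (hpos k) _ _ (hp k))
    rw [← ENNReal.ofReal_tsum_of_nonneg (fun k => (hpos k).le) summable_geometric_two]
    exact ENNReal.ofReal_ne_top
  filter_upwards [hae, hW] with ω hω hWω
  have hlt : ∀ᶠ k in atTop, ∀ s ≤ S,
      |riemannSum H W (n k) (p k) s ω - I s ω| < (1 / 2 : ℝ) ^ k := by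
    filter_upwards [hω] with k hk s hs
    by_contra hc
    exact hk ⟨s, hs, not_lt.1 hc⟩
  have hzero : Tendsto (fun k : ℕ => (1 / 2 : ℝ) ^ k) atTop (𝓝 0) :=
    tendsto_pow_atTop_nhds_zero_of_lt_one (by norm_num) (by norm_num)
  constructor
  · have hu : TendstoUniformlyOn (fun k s => riemannSum H W (n k) (p k) s ω) (fun s => I s ω)
        atTop (Iic S) := by
      refine Metric.tendstoUniformlyOn_iff.2 fun ε hε => ?_
      filter_upwards [hlt, hzero.eventually (gt_mem_nhds hε)] with k hk hkε s hs
      rw [dist_comm, Real.dist_eq]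
      exact (hk s hs).trans hkε
    exact hu.continuousOn (Frequently.of_forall fun k => (continuous_riemannSum hWω _ _).continuousOn)
  · have h0 : ∀ k, riemannSum H W (n k) (p k) 0 ω = 0 := fun k => by simp [riemannSum]
    have h1 : ∀ᶠ k : ℕ in atTop, |I 0 ω| ≤ (1 / 2 : ℝ) ^ k := by
      filter_upwards [hlt] with k hk
      simpa [h0] using (hk 0 zero_le).le
    exact abs_nonpos_iff.1 (ge_of_tendsto hzero h1)

/-! ### Switching between two integrands -/

open Classical in
/-- The Riemann sums of an integrand that switches at the crossing time differ from the switched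
Riemann sums by the contribution of at most one interval of the partition. -/
theorem riemannSum_ite_crossed {D : ℝ≥0 → ℝ} (hD : ∀ s, ContinuousWithinAt D (Ici s) s)
    {H₁ H₂ W : ℝ≥0 → Ω → ℝ} {ω : Ω} {S δ : ℝ≥0} {n : ℕ} {p : ℕ → ℝ≥0} (hp : IsPartition S δ n p)
    {s : ℝ≥0} (hs : s ≤ S) {B : ℝ} (hB0 : 0 ≤ B)
    (hB : ∀ u ≤ S, ∀ b a : ℝ≥0, b ≤ a → a ≤ S → a ≤ b + δ →
      |H₁ u ω - H₂ u ω| * |W a ω - W b ω| ≤ B) :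
    |riemannSum (fun u ω => if Crossed D u then H₂ u ω else H₁ u ω) W n p s ω -
      (if Crossed D s then riemannSum H₁ W n p (crossingTime D) ω +
        (riemannSum H₂ W n p s ω - riemannSum H₂ W n p (crossingTime D) ω)
      else riemannSum H₁ W n p s ω)| ≤ B := by
  by_cases hc : Crossed D s
  · set ρ := crossingTime D
    have hρs : ρ ≤ s := hc.crossingTime_le
    have hiff : ∀ u, Crossed D u ↔ ρ ≤ u := fun u => hc.crossed_iff hD
    rw [if_pos hc]
    simp only [hiff, riemannSum, ← Finset.sum_sub_distrib, ← Finset.sum_add_distrib]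
    -- Only an interval with `ρ` strictly inside contributes: elsewhere both sums use the same
    -- integrand over the whole interval.
    have hz : ∀ i, ¬ (p i < ρ ∧ ρ < p (i + 1)) →
        (if ρ ≤ p i then H₂ (p i) ω else H₁ (p i) ω) *
            (W (min (p (i + 1)) s) ω - W (min (p i) s) ω) -
          (H₁ (p i) ω * (W (min (p (i + 1)) ρ) ω - W (min (p i) ρ) ω) +
            (H₂ (p i) ω * (W (min (p (i + 1)) s) ω - W (min (p i) s) ω) -
              H₂ (p i) ω * (W (min (p (i + 1)) ρ) ω - W (min (p i) ρ) ω))) = 0 := by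
      intro i hi
      by_cases h1 : ρ ≤ p i
      · rw [if_pos h1, min_eq_right h1, min_eq_right (h1.trans (hp.mono i.le_succ))]
        ring
      · have h2 : p i < ρ := not_le.1 h1
        have h3 : p (i + 1) ≤ ρ := not_lt.1 fun h => hi ⟨h2, h⟩
        rw [if_neg h1, min_eq_left h2.le, min_eq_left h3, min_eq_left (h2.le.trans hρs),
          min_eq_left (h3.trans hρs)]
        ring
    by_cases hex : ∃ i ∈ Finset.range n, p i < ρ ∧ ρ < p (i + 1)
    · obtain ⟨i, hi, h1, h2⟩ := hex
      rw [Finset.sum_eq_single i]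
      · have hin := Finset.mem_range.1 hi
        rw [if_neg (not_le.2 h1), min_eq_left h1.le, min_eq_right h2.le,
          min_eq_left (h1.le.trans hρs)]
        -- On the straddling interval the discrepancy is `H₁ - H₂` at `p i` times the increment of
        -- `W` after `ρ`.
        have h3 := hB (p i) (hp.le hin.le) ρ (min (p (i + 1)) s) (le_min h2.le hρs)
          ((min_le_right _ _).trans hs)
          ((min_le_left _ _).trans ((hp.mesh i hin).trans (by gcongr)))
        rw [← abs_mul] at h3
        refine (le_of_eq (congrArg abs ?_)).trans h3
        ring
      · intro j _ hji
        refine hz j fun h => ?_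
        rcases lt_or_gt_of_ne hji with h3 | h3
        · exact absurd (h.2.trans_le (hp.mono (Nat.succ_le_of_lt h3))) (not_lt.2 h1.le)
        · exact absurd (h2.trans_le (hp.mono (Nat.succ_le_of_lt h3))) (not_lt.2 h.1.le)
      · exact fun h => absurd hi h
    · rw [Finset.sum_eq_zero fun i hi => hz i fun h => hex ⟨i, hi, h⟩]
      simpa using hB0
  · rw [if_neg hc]
    have : riemannSum (fun u ω => if Crossed D u then H₂ u ω else H₁ u ω) W n p s ω =
        riemannSum H₁ W n p s ω := by
      refine Finset.sum_congr rfl fun i _ => ?_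
      by_cases h1 : Crossed D (p i)
      · have h2 : s ≤ p i := le_of_not_ge fun h => hc (h1.mono h)
        rw [min_eq_right h2, min_eq_right (h2.trans (hp.mono i.le_succ))]
        ring
      · simp only [if_neg h1]
    simpa [this] using hB0

/-- For a càdlàg process `D` and a continuous process `W`, products of values of `D` with small
increments of `W` are uniformly small, outside a set of small measure. -/
theorem exists_modulus [IsFiniteMeasure P] {D : ℝ≥0 → Ω → ℝ} (hDm : ∀ s, Measurable (D s))
    (hD : ∀ ω, CadlagPath fun s => D s ω) (hWm : ∀ s, Measurable (W s))
    (hW : ∀ᵐ ω ∂P, Continuous fun s => W s ω) (S : ℝ≥0) {η : ℝ} (hη : 0 < η) :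
    ∃ δ : ℝ≥0, 0 < δ ∧ P {ω | ∃ u ≤ S, ∃ b a : ℝ≥0, b ≤ a ∧ a ≤ S ∧ a ≤ b + δ ∧
      η < |D u ω| * |W a ω - W b ω|} ≤ ENNReal.ofReal η := by
  let q := TopologicalSpace.denseSeq ℝ≥0
  -- A countable, hence measurable, version of the bad event; `S + 1` leaves room for dense
  -- approximations of times up to `S`.
  let V : ℕ → Set Ω := fun n => ⋃ (i : ℕ) (j : ℕ) (k : ℕ),
    {ω | (q i ≤ S + 1 ∧ q j ≤ S + 1 ∧ q k ≤ S + 1 ∧ dist (q j) (q k) < 1 / ((n : ℝ) + 1)) ∧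
      η < |D (q i) ω| * |W (q j) ω - W (q k) ω|}
  have hVm : ∀ n, MeasurableSet (V n) := fun n =>
    MeasurableSet.iUnion fun i => MeasurableSet.iUnion fun j => MeasurableSet.iUnion fun k =>
      (MeasurableSet.const _).inter (measurableSet_lt measurable_const
        ((hDm _).abs.mul ((hWm _).sub (hWm _)).abs))
  have hVanti : Antitone V := by
    intro n n' hn ω hω
    simp only [V, mem_iUnion] at hω ⊢
    obtain ⟨i, j, k, ⟨h1, h2, h3, h4⟩, h5⟩ := hω
    refine ⟨i, j, k, ⟨h1, h2, h3, h4.trans_le ?_⟩, h5⟩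
    gcongr
  -- On a path with `W` continuous, `D` is bounded and `W` uniformly continuous on `[0,S+1]`, so the
  -- product cannot exceed `η` at every mesh.
  have hnull : P (⋂ n, V n) = 0 := by
    refine measure_mono_null ?_ (ae_iff.1 hW)
    intro ω hω hWω
    obtain ⟨C, hC⟩ := (hD ω).exists_bound (S + 1)
    have hC0 : 0 ≤ C := (abs_nonneg _).trans (hC 0 zero_le)
    have huc := isCompact_Icc.uniformContinuousOn_of_continuous
      (hWω.continuousOn (s := Icc (0 : ℝ≥0) (S + 1)))
    obtain ⟨d, hd, hdist⟩ := Metric.uniformContinuousOn_iff.1 huc (η / (C + 1)) (by positivity)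
    obtain ⟨n, hn⟩ := exists_nat_one_div_lt hd
    have hωn := mem_iInter.1 hω n
    simp only [V, mem_iUnion] at hωn
    obtain ⟨i, j, k, ⟨h1, h2, h3, h4⟩, h5⟩ := hωn
    have h6 := hdist _ ⟨zero_le, h2⟩ _ ⟨zero_le, h3⟩ (h4.trans hn)
    rw [Real.dist_eq] at h6
    have h7 : |D (q i) ω| * |W (q j) ω - W (q k) ω| ≤ C * (η / (C + 1)) :=
      mul_le_mul (hC _ h1) h6.le (abs_nonneg _) hC0
    have h8 : C * (η / (C + 1)) ≤ η := by
      rw [mul_div_assoc', div_le_iff₀ (by positivity)]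
      nlinarith
    exact absurd h5 (not_lt.2 (h7.trans h8))
  have htend := tendsto_measure_iInter_atTop (μ := P) (fun n => (hVm n).nullMeasurableSet) hVanti
    ⟨0, measure_ne_top _ _⟩
  rw [hnull] at htend
  obtain ⟨n, hn⟩ := (htend.eventually (gt_mem_nhds (ENNReal.ofReal_pos.2 hη))).exists
  -- `n + 2` makes the distance strictly below `1/(n+1)`, an open condition that passes to dense
  -- times.
  refine ⟨1 / ((n : ℝ≥0) + 2), by positivity, ?_⟩
  refine (measure_mono_ae ?_).trans hn.le
  filter_upwards [hW] with ω hWω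
  rintro ⟨u, hu, b, a, hba, haS, hab, hlt⟩
  have hS1 : S < S + 1 := lt_add_of_pos_right _ one_pos
  obtain ⟨i, -, hi, h1⟩ := exists_denseSeq_between
    (f := fun u => |D u ω| * |W a ω - W b ω|)
    (((hD ω u).1.abs).mul continuousWithinAt_const) (hu.trans_lt hS1) isOpen_Ioi hlt
  have hdist : dist a b < 1 / ((n : ℝ) + 1) := by
    rw [NNReal.dist_eq, abs_of_nonneg (sub_nonneg.2 (NNReal.coe_le_coe.2 hba))]
    have h2 : (a : ℝ) ≤ b + 1 / ((n : ℝ) + 2) := by exact_mod_cast hab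
    have h3 : 1 / ((n : ℝ) + 2) < 1 / ((n : ℝ) + 1) := by
      apply one_div_lt_one_div_of_lt <;> first | positivity | linarith
    linarith
  have hopen : IsOpen {z : ℝ≥0 × ℝ≥0 | z.1 < S + 1 ∧ z.2 < S + 1 ∧
      dist z.1 z.2 < 1 / ((n : ℝ) + 1) ∧
      η < |D (q i) ω| * |W z.1 ω - W z.2 ω|} := by
    have hcont : Continuous fun z : ℝ≥0 × ℝ≥0 => |D (q i) ω| * |W z.1 ω - W z.2 ω| :=
      continuous_const.mul ((hWω.comp continuous_fst).sub (hWω.comp continuous_snd)).abs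
    exact (isOpen_lt continuous_fst continuous_const).inter
      ((isOpen_lt continuous_snd continuous_const).inter
      ((isOpen_lt (continuous_fst.dist continuous_snd) continuous_const).inter
      (isOpen_lt continuous_const hcont)))
  have hdense : DenseRange (Prod.map q q) :=
    (TopologicalSpace.denseRange_denseSeq ℝ≥0).prodMap (TopologicalSpace.denseRange_denseSeq ℝ≥0)
  obtain ⟨⟨j, k⟩, hj, hk, h2, h3⟩ := hdense.exists_mem_open hopen
    ⟨(a, b), haS.trans_lt hS1, (hba.trans haS).trans_lt hS1, hdist, h1⟩
  exact mem_iUnion.2 ⟨i, mem_iUnion.2 ⟨j, mem_iUnion.2 ⟨k, ⟨hi.le, hj.le, hk.le, h2⟩, h3⟩⟩⟩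

open Classical in
/-- The Itô integral of an integrand that switches from `H₁` to `H₂` at the crossing time of a
càdlàg process `D` dominating `H₁ - H₂`. -/
theorem IsItoIntegral.ite_crossed [IsFiniteMeasure P] {D H₁ H₂ I₁ I₂ : ℝ≥0 → Ω → ℝ}
    (hDm : ∀ s, Measurable (D s)) (hD : ∀ ω, CadlagPath fun s => D s ω)
    (hWm : ∀ s, Measurable (W s)) (hW : ∀ᵐ ω ∂P, Continuous fun s => W s ω) {S : ℝ≥0}
    (h₁ : IsItoIntegral P H₁ W I₁ S) (h₂ : IsItoIntegral P H₂ W I₂ S)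
    {K : ℝ} (hH : ∀ᵐ ω ∂P, ∀ s ≤ S, |H₁ s ω - H₂ s ω| ≤ |K * D s ω|) :
    IsItoIntegral P
      (fun s ω => if Crossed (fun u => D u ω) s then H₂ s ω else H₁ s ω) W
      (fun s ω => if Crossed (fun u => D u ω) s then
        I₁ (crossingTime fun u => D u ω) ω + (I₂ s ω - I₂ (crossingTime fun u => D u ω) ω)
        else I₁ s ω) S := by
  intro ε hε
  -- At most four errors of size `ε/5` enter: `I₁` at the crossing, `I₂` there and at `s`, and the
  -- straddling interval. The bad events have total probability at most `3ε/5`.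
  have hη : 0 < ε / 5 := by positivity
  obtain ⟨δ₁, hδ₁, hP₁⟩ := h₁ _ hη
  obtain ⟨δ₂, hδ₂, hP₂⟩ := h₂ _ hη
  obtain ⟨δ₃, hδ₃, hP₃⟩ := exists_modulus (D := fun s ω => K * D s ω)
    (fun s => (hDm s).const_mul K) (fun ω => (hD ω).const_mul K) hWm hW S hη
  refine ⟨min δ₁ (min δ₂ δ₃), lt_min hδ₁ (lt_min hδ₂ hδ₃), fun n p hp => ?_⟩
  have hp₁ := hP₁ n p (hp.mesh_mono (min_le_left _ _))
  have hp₂ := hP₂ n p (hp.mesh_mono ((min_le_right _ _).trans (min_le_left _ _)))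
  have hp₃ := hp.mesh_mono ((min_le_right _ _).trans (min_le_right _ _))
  have hsub : ∀ᵐ ω ∂P, ω ∈ {ω | ∃ s ≤ S, ε ≤ |riemannSum
        (fun s ω => if Crossed (fun u => D u ω) s then H₂ s ω else H₁ s ω) W n p s ω -
        (if Crossed (fun u => D u ω) s then
        I₁ (crossingTime fun u => D u ω) ω + (I₂ s ω - I₂ (crossingTime fun u => D u ω) ω)
        else I₁ s ω)|} →
      ω ∈ ({ω | ∃ s ≤ S, ε / 5 ≤ |riemannSum H₁ W n p s ω - I₁ s ω|} ∪
        {ω | ∃ s ≤ S, ε / 5 ≤ |riemannSum H₂ W n p s ω - I₂ s ω|}) ∪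
        {ω | ∃ u ≤ S, ∃ b a : ℝ≥0, b ≤ a ∧ a ≤ S ∧ a ≤ b + δ₃ ∧
          ε / 5 < |K * D u ω| * |W a ω - W b ω|} := by
    filter_upwards [hH] with ω hHω
    rintro ⟨s, hs, hle⟩
    by_contra hnot
    simp only [mem_union, mem_ofPred_eq, not_or, not_exists, not_and, not_le, not_lt] at hnot
    obtain ⟨⟨hn₁, hn₂⟩, hn₃⟩ := hnot
    have hR := riemannSum_ite_crossed (D := fun u => D u ω) (fun s => (hD ω s).1) (H₁ := H₁)
      (H₂ := H₂) (W := W) (ω := ω) hp₃ hs hη.le fun u hu b a hba ha hab =>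
        (mul_le_mul_of_nonneg_right (hHω u hu) (abs_nonneg _)).trans (hn₃ u hu b a hba ha hab)
    have hform : riemannSum
        (fun s ω' => if Crossed (fun u => D u ω) s then H₂ s ω' else H₁ s ω') W n p s ω =
        riemannSum (fun s ω => if Crossed (fun u => D u ω) s then H₂ s ω else H₁ s ω) W n p s ω :=
      rfl
    rw [hform] at hR
    revert hle hR
    by_cases hc : Crossed (fun u => D u ω) s
    · simp only [if_pos hc]
      intro hle hR
      have a1 := abs_lt.1 (hn₁ _ (hc.crossingTime_le.trans hs))
      have a2 := abs_lt.1 (hn₂ _ (hc.crossingTime_le.trans hs))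
      have a3 := abs_lt.1 (hn₂ _ hs)
      have a4 := abs_le.1 hR
      rcases le_abs.1 hle with h | h <;> linarith [a1.1, a1.2, a2.1, a2.2, a3.1, a3.2, a4.1, a4.2]
    · simp only [if_neg hc]
      intro hle hR
      have a1 := abs_lt.1 (hn₁ _ hs)
      have a4 := abs_le.1 hR
      rcases le_abs.1 hle with h | h <;> linarith [a1.1, a1.2, a4.1, a4.2]
  calc _ ≤ _ := measure_mono_ae hsub
    _ ≤ (ENNReal.ofReal (ε / 5) + ENNReal.ofReal (ε / 5)) + ENNReal.ofReal (ε / 5) :=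
      (measure_union_le _ _).trans
        (add_le_add ((measure_union_le _ _).trans (add_le_add hp₁ hp₂)) hP₃)
    _ ≤ ENNReal.ofReal ε := by
      rw [← ENNReal.ofReal_add hη.le hη.le, ← ENNReal.ofReal_add (by positivity) hη.le]
      exact ENNReal.ofReal_le_ofReal (by linarith)

end ItoIntegral

/-! ### Regularity of the data -/

theorem LocallyHolderOn.continuousOn {E : Type*} [MetricSpace E] [ProperSpace E] {f : E → ℝ}
    {D : Set E} (hD : IsClosed D) (h : LocallyHolderOn f D) : ContinuousOn f D := by
  obtain ⟨γ, hγ, -, hK⟩ := h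
  intro z hz
  obtain ⟨C, hC⟩ := hK (D ∩ Metric.closedBall z 1) inter_subset_left
    ((isCompact_closedBall z 1).inter_left hD)
  have h1 := hC.continuousOn hγ z ⟨hz, Metric.mem_closedBall_self zero_le_one⟩
  exact h1.mono_of_mem_nhdsWithin
    (inter_mem_nhdsWithin D (Metric.closedBall_mem_nhds z one_pos))

/-- A càdlàg path stays in a compact part of `A`, on which `G` is bounded; the composite inherits
right-continuity. -/
theorem intervalIntegrable_comp_cadlag {G : ℝ × ℝ → ℝ} {A : Set ℝ} (hA : IsClosed A) {t T : ℝ}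
    {S : ℝ≥0} (ht : 0 ≤ t) (htT : t + S ≤ T) (hG : ContinuousOn G (Icc 0 T ×ˢ A)) {f : ℝ≥0 → ℝ}
    (hf : CadlagPath f) (hfA : ∀ s ≤ S, f s ∈ A) :
    IntervalIntegrable (fun s : ℝ => G (t + s, f s.toNNReal)) volume 0 S := by
  have hmem : ∀ s ≤ S, ((t + s, f s) : ℝ × ℝ) ∈ Icc 0 T ×ˢ A := fun s hs =>
    ⟨⟨by positivity, by have := NNReal.coe_le_coe.2 hs; linarith⟩, hfA s hs⟩
  obtain ⟨C, hC⟩ := hf.exists_bound S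
  have hcomp : IsCompact (Icc 0 T ×ˢ (A ∩ Icc (-C) C)) :=
    isCompact_Icc.prod (isCompact_Icc.inter_left hA)
  obtain ⟨B, hB⟩ := hcomp.exists_bound_of_continuousOn
    (hG.mono (prod_mono_right inter_subset_left))
  have hint := intervalIntegrable_of_rightContinuous (f := fun s => G (t + s, f s)) (S := S)
    (fun s hs => ?_) (C := B)
    (fun s hs => hB _ ⟨(hmem s hs.le).1, (hmem s hs.le).2, abs_le.1 (hC s hs.le)⟩)
  · refine hint.congr fun s hs => ?_
    rw [uIoc_of_le NNReal.zero_le_coe] at hs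
    simp [Real.coe_toNNReal s hs.1.le]
  · refine (hG _ (hmem s hs.le)).tendsto.comp (tendsto_nhdsWithin_iff.2 ⟨?_, ?_⟩)
    · have h1 : ContinuousWithinAt (fun u : ℝ≥0 => t + (u : ℝ)) (Ici s) s := by fun_prop
      exact h1.tendsto.prodMk_nhds (hf s).1
    · filter_upwards [mem_nhdsWithin_of_mem_nhds (Iio_mem_nhds hs)] with u hu
      exact hmem u (le_of_lt hu)

/-! ### Coupled paths -/

/-- A path `X` that starts from `y` and is controlled by `n`, and an uncontrolled path `Z` that
starts from `x ≤ y`. -/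
structure CoupledPaths (d : GameData) (S : ℝ≥0) (x y : ℝ) (X Z n I J : ℝ≥0 → ℝ) : Prop where
  le : x ≤ y
  continuousOn_μ : ContinuousOn d.μ (closure d.O)
  cadlag_X : CadlagPath X
  cadlag_Z : CadlagPath Z
  eq_X : ∀ s ≤ S, X s = y + (∫ u in (0 : ℝ)..s, d.μ (X u.toNNReal)) + I s + n s
  eq_Z : ∀ s ≤ S, Z s = x + (∫ u in (0 : ℝ)..s, d.μ (Z u.toNNReal)) + J s + 0
  cont_I : ContinuousOn I (Iic S) ∧ I 0 = 0
  cont_J : ContinuousOn J (Iic S) ∧ J 0 = 0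
  mem_X : ∀ s ≤ S, X s ∈ closure d.O
  mem_Z : ∀ s ≤ S, Z s ∈ d.O

open Classical in
/-- Follow `Z` until `X - Z` crosses zero, and `X` from then on. -/
noncomputable def switchPath (X Z : ℝ≥0 → ℝ) (s : ℝ≥0) : ℝ :=
  if Crossed (fun u => X u - Z u) s then X s else Z s

open Classical in
/-- The control `f` restarted at the crossing time of `D` from the value `j` of a jump. -/
noncomputable def restartPath (D f : ℝ≥0 → ℝ) (j : ℝ) (s : ℝ≥0) : ℝ :=
  if Crossed D s then j + (f s - f (crossingTime D)) else 0

section Restart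

variable {D f : ℝ≥0 → ℝ} {j : ℝ}

theorem restartPath_nonneg (hf : Monotone f) (hj : 0 ≤ j) (s : ℝ≥0) : 0 ≤ restartPath D f j s := by
  unfold restartPath
  split_ifs with h
  · have := hf h.crossingTime_le
    linarith
  · exact le_rfl

theorem monotone_restartPath (hf : Monotone f) (hj : 0 ≤ j) : Monotone (restartPath D f j) := by
  intro s u hsu
  by_cases hs : Crossed D s
  · simp only [restartPath, if_pos hs, if_pos (hs.mono hsu)]
    have := hf hsu
    linarith
  · have h0 : restartPath D f j s = 0 := if_neg hs
    rw [h0]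
    exact restartPath_nonneg hf hj u

theorem restartPath_rightContinuous (hD : ∀ s, ContinuousWithinAt D (Ici s) s)
    (hf : ∀ s, ContinuousWithinAt f (Ici s) s) (s : ℝ≥0) :
    ContinuousWithinAt (restartPath D f j) (Ici s) s := by
  by_cases hs : Crossed D s
  · refine ((continuousWithinAt_const (b := j)).add ((hf s).sub
      (continuousWithinAt_const (b := f (crossingTime D))))).congr (fun u hu => ?_) ?_
    · exact if_pos (hs.mono hu)
    · exact if_pos hs
  · refine (continuousWithinAt_const (b := (0 : ℝ))).congr_of_eventuallyEq ?_ (if_neg hs)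
    filter_upwards [eventually_not_crossed (hD s) hs] with u hu
    exact if_neg hu

theorem restartPath_le (hf : ∀ s, 0 ≤ f s) (s : ℝ≥0)
    (hj : Crossed D s → j ≤ f (crossingTime D)) : restartPath D f j s ≤ f s := by
  unfold restartPath
  split_ifs with h
  · linarith [hj h]
  · exact hf s

end Restart

/-! ### The switched path and its equation -/

namespace CoupledPaths

variable {d : GameData} {S : ℝ≥0} {x y : ℝ} {X Z n I J : ℝ≥0 → ℝ}

theorem rightContinuous_sub (h : CoupledPaths d S x y X Z n I J) (s : ℝ≥0) :
    ContinuousWithinAt (fun u => X u - Z u) (Ici s) s := (h.cadlag_X.sub h.cadlag_Z s).1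

theorem cadlag_switchPath (h : CoupledPaths d S x y X Z n I J) : CadlagPath (switchPath X Z) :=
  cadlagPath_ite_crossed h.rightContinuous_sub h.cadlag_X h.cadlag_Z

theorem switchPath_le (s : ℝ≥0) : switchPath X Z s ≤ X s := by
  unfold switchPath
  split_ifs with hc
  · exact le_rfl
  · linarith [pos_of_not_crossed hc]

theorem switchPath_mem (h : CoupledPaths d S x y X Z n I J) {s : ℝ≥0} (hs : s ≤ S) :
    switchPath X Z s ∈ closure d.O := by
  unfold switchPath
  split_ifs
  · exact h.mem_X s hs
  · exact subset_closure (h.mem_Z s hs)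

theorem intervalIntegrable_drift (h : CoupledPaths d S x y X Z n I J) {f : ℝ≥0 → ℝ}
    (hf : CadlagPath f) (hfO : ∀ s ≤ S, f s ∈ closure d.O) :
    IntervalIntegrable (fun s : ℝ => d.μ (f s.toNNReal)) volume 0 S :=
  intervalIntegrable_comp_cadlag (G := fun p => d.μ p.2) (T := S) isClosed_closure le_rfl
    (by simp) (h.continuousOn_μ.comp continuousOn_snd fun _ hp => hp.2) hf hfO

theorem continuousOn_drift (h : CoupledPaths d S x y X Z n I J) {f : ℝ≥0 → ℝ}
    (hf : CadlagPath f) (hfO : ∀ s ≤ S, f s ∈ closure d.O) :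
    ContinuousOn (fun s : ℝ≥0 => ∫ u in (0 : ℝ)..s, d.μ (f u.toNNReal)) (Iic S) := by
  have h1 := intervalIntegral.continuousOn_primitive_interval'
    (h.intervalIntegrable_drift hf hfO) left_mem_uIcc
  refine h1.comp NNReal.continuous_coe.continuousOn fun s hs => ?_
  rw [uIcc_of_le NNReal.zero_le_coe]
  exact ⟨NNReal.zero_le_coe, NNReal.coe_le_coe.2 hs⟩

/-- Subtracting the two equations leaves `y - x`, the control, and differences of drift and
stochastic integrals. Of the latter only continuity matters. -/
theorem jump (h : CoupledPaths d S x y X Z n I J) {a : ℝ → ℝ} {l : ℝ} (ha : ∀ s < 0, a s = 0)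
    (han : ∀ s ≤ S, a (s : ℝ≥0) = n s) (hc : Crossed (fun u => X u - Z u) S)
    (hl : Tendsto a (𝓝[<] (crossingTime fun u => X u - Z u : ℝ≥0)) (𝓝 l)) :
    (X (crossingTime fun u => X u - Z u) - Z (crossingTime fun u => X u - Z u) ≤ 0 →
      n (crossingTime fun u => X u - Z u) - l ≤
        X (crossingTime fun u => X u - Z u) - Z (crossingTime fun u => X u - Z u)) ∧
    (0 < X (crossingTime fun u => X u - Z u) - Z (crossingTime fun u => X u - Z u) →
      X (crossingTime fun u => X u - Z u) - Z (crossingTime fun u => X u - Z u) =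
        n (crossingTime fun u => X u - Z u) - l) := by
  have hZ : ∀ s ≤ S, Z s ∈ closure d.O := fun s hs => subset_closure (h.mem_Z s hs)
  rw [← han _ hc.crossingTime_le]
  refine crossingTime_jump (δ := y - x)
    (k := fun s => ((∫ u in (0 : ℝ)..s, d.μ (X u.toNNReal)) -
      ∫ u in (0 : ℝ)..s, d.μ (Z u.toNNReal)) + (I s - J s))
    h.rightContinuous_sub (sub_nonneg.2 h.le) ?_ ?_ ha (fun s hs => ?_) hc hl
  · exact ((h.continuousOn_drift h.cadlag_X h.mem_X).sub (h.continuousOn_drift h.cadlag_Z hZ)).add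
      (h.cont_I.1.sub h.cont_J.1)
  · simp [h.cont_I.2, h.cont_J.2]
  · rw [han s hs, h.eq_Z s hs]
    linarith [h.eq_X s hs]

open Classical in
/-- The switched path solves the equation driven by the restarted control. -/
theorem switchPath_eq (h : CoupledPaths d S x y X Z n I J) {s : ℝ≥0} (hs : s ≤ S) :
    switchPath X Z s = x + (∫ u in (0 : ℝ)..s, d.μ (switchPath X Z u.toNNReal)) +
      (if Crossed (fun u => X u - Z u) s then J (crossingTime fun u => X u - Z u) +
        (I s - I (crossingTime fun u => X u - Z u)) else J s) +
      restartPath (fun u => X u - Z u) n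
        (X (crossingTime fun u => X u - Z u) - Z (crossingTime fun u => X u - Z u)) s := by
  by_cases hc : Crossed (fun u => X u - Z u) s
  · have hρs := hc.crossingTime_le
    have hiff : ∀ u, Crossed (fun u => X u - Z u) u ↔ crossingTime (fun u => X u - Z u) ≤ u :=
      fun u => hc.crossed_iff h.rightContinuous_sub
    have hsw : switchPath X Z s = X s := if_pos hc
    rw [hsw, restartPath, if_pos hc, if_pos hc]
    -- Adding the jump `X ρ - Z ρ` to the equation of `Z` at `ρ` gives `X ρ`; the equations of `X`
    -- at `ρ` and `s` supply the increment from there.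
    have hXs := h.eq_X s hs
    have hXρ := h.eq_X _ (hρs.trans hs)
    have hZρ := h.eq_Z _ (hρs.trans hs)
    have hsw1 : ∀ u, u < crossingTime (fun u => X u - Z u) → switchPath X Z u = Z u :=
      fun u hu => if_neg (not_crossed_of_lt hu)
    have hsw2 : ∀ u, crossingTime (fun u => X u - Z u) ≤ u → switchPath X Z u = X u :=
      fun u hu => if_pos ((hiff u).2 hu)
    generalize crossingTime (fun u => X u - Z u) = ρ at *
    have hρs' : (ρ : ℝ) ≤ s := NNReal.coe_le_coe.2 hρs
    have hs' : (s : ℝ) ≤ S := NNReal.coe_le_coe.2 hs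
    have hsub1 : uIcc (0 : ℝ) ρ ⊆ uIcc 0 S := by
      rw [uIcc_of_le NNReal.zero_le_coe, uIcc_of_le NNReal.zero_le_coe]
      exact Icc_subset_Icc_right (hρs'.trans hs')
    have hsub2 : uIcc (ρ : ℝ) s ⊆ uIcc 0 S := by
      rw [uIcc_of_le hρs', uIcc_of_le NNReal.zero_le_coe]
      exact Icc_subset_Icc NNReal.zero_le_coe hs'
    have hiX := h.intervalIntegrable_drift h.cadlag_X h.mem_X
    have hiY := h.intervalIntegrable_drift h.cadlag_switchPath fun s hs => h.switchPath_mem hs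
    have e1 := intervalIntegral.integral_add_adjacent_intervals (hiX.mono_set hsub1)
      (hiX.mono_set hsub2)
    have e2 := intervalIntegral.integral_add_adjacent_intervals (hiY.mono_set hsub1)
      (hiY.mono_set hsub2)
    have e3 : ∫ u in (0 : ℝ)..ρ, d.μ (switchPath X Z u.toNNReal) =
        ∫ u in (0 : ℝ)..ρ, d.μ (Z u.toNNReal) := by
      rw [intervalIntegral.integral_of_le NNReal.zero_le_coe,
        intervalIntegral.integral_of_le NNReal.zero_le_coe, integral_Ioc_eq_integral_Ioo,
        integral_Ioc_eq_integral_Ioo]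
      refine setIntegral_congr_fun measurableSet_Ioo fun u hu => ?_
      rw [hsw1 _ ((Real.toNNReal_lt_iff_lt_coe hu.1.le).2 hu.2)]
    have e4 : ∫ u in (ρ : ℝ)..s, d.μ (switchPath X Z u.toNNReal) =
        ∫ u in (ρ : ℝ)..s, d.μ (X u.toNNReal) := by
      refine intervalIntegral.integral_congr fun u hu => ?_
      rw [uIcc_of_le hρs'] at hu
      rw [hsw2 _ (NNReal.le_toNNReal_of_coe_le hu.1)]
    linarith
  · have hsw : switchPath X Z s = Z s := if_neg hc
    have hz : restartPath (fun u => X u - Z u) n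
        (X (crossingTime fun u => X u - Z u) - Z (crossingTime fun u => X u - Z u)) s = 0 := if_neg hc
    rw [hsw, hz, if_neg hc, h.eq_Z s hs]
    congr 3
    refine intervalIntegral.integral_congr fun u hu => ?_
    rw [uIcc_of_le NNReal.zero_le_coe] at hu
    have : switchPath X Z u.toNNReal = Z u.toNNReal :=
      if_neg fun hcu => hc (hcu.mono (Real.toNNReal_le_iff_le_coe.2 hu.2))
    rw [this]

end CoupledPaths

section Control

variable {Ω : Type*} {m : MeasurableSpace Ω} {F : Filtration ℝ≥0 m}

/-! ### The restarted control -/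

/-- `φ` will be the positive or the negative part, charging the jump to `up` or to `down`. -/
theorem adapted_restartPath {D A : ℝ≥0 → Ω → ℝ} (hD : Adapted F D)
    (hr : ∀ ω s, ContinuousWithinAt (fun u => D u ω) (Ici s) s) (hA : Adapted F A)
    (hAr : ∀ ω s, ContinuousWithinAt (fun u => A u ω) (Ici s) s) {φ : ℝ → ℝ} (hφ : Measurable φ) :
    Adapted F fun s ω => restartPath (fun u => D u ω) (fun u => A u ω)
      (φ (D (crossingTime fun u => D u ω) ω)) s := by
  classical
  intro s
  have h1 := measurable_ite_crossed_crossingTime hD hr hD hr s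
  have h2 := measurable_ite_crossed_crossingTime hD hr hA hAr s
  have h3 : Measurable[F s] fun ω => if Crossed (fun u => D u ω) s then
      φ (if Crossed (fun u => D u ω) s then D (crossingTime fun u => D u ω) ω else 0) +
        (A s ω - if Crossed (fun u => D u ω) s then A (crossingTime fun u => D u ω) ω else 0)
      else 0 :=
    Measurable.ite (measurableSet_crossed hD hr s) ((hφ.comp h1).add ((hA s).sub h2))
      measurable_const
  refine (congrArg (Measurable[F s]) (funext fun ω => ?_)).mp h3
  by_cases hc : Crossed (fun u => D u ω) s <;> simp [restartPath, hc]

/-- The control that does nothing before the crossing time of `X - Z`, moves the state from `Z` to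
`X` at that time, and follows `c` afterwards. -/
noncomputable def SingularControl.restart (c : SingularControl F) {X Z : ℝ≥0 → Ω → ℝ}
    (hX : Adapted F X) (hZ : Adapted F Z) (hXc : IsCadlag X) (hZc : IsCadlag Z) :
    SingularControl F where
  up s ω := restartPath (fun u => X u ω - Z u ω) (fun u => c.up u ω)
    (max (X (crossingTime fun u => X u ω - Z u ω) ω - Z (crossingTime fun u => X u ω - Z u ω) ω) 0) s
  down s ω := restartPath (fun u => X u ω - Z u ω) (fun u => c.down u ω)
    (max (-(X (crossingTime fun u => X u ω - Z u ω) ω -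
      Z (crossingTime fun u => X u ω - Z u ω) ω)) 0) s
  adapted_up := adapted_restartPath (D := fun u ω => X u ω - Z u ω) (φ := fun z => max z 0)
    (fun s => (hX s).sub (hZ s)) (fun ω s => (hXc ω s).1.sub (hZc ω s).1) c.adapted_up
    c.rightCont_up (measurable_id.max measurable_const)
  adapted_down := adapted_restartPath (D := fun u ω => X u ω - Z u ω) (φ := fun z => max (-z) 0)
    (fun s => (hX s).sub (hZ s)) (fun ω s => (hXc ω s).1.sub (hZc ω s).1) c.adapted_down
    c.rightCont_down (measurable_neg.max measurable_const)
  mono_up ω := monotone_restartPath (c.mono_up ω) (le_max_right _ _)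
  mono_down ω := monotone_restartPath (c.mono_down ω) (le_max_right _ _)
  rightCont_up ω := restartPath_rightContinuous (fun s => (hXc ω s).1.sub (hZc ω s).1)
    (c.rightCont_up ω)
  rightCont_down ω := restartPath_rightContinuous (fun s => (hXc ω s).1.sub (hZc ω s).1)
    (c.rightCont_down ω)
  nonneg_up ω := restartPath_nonneg (c.mono_up ω) (le_max_right _ _) 0
  nonneg_down ω := restartPath_nonneg (c.mono_down ω) (le_max_right _ _) 0

theorem SingularControl.up_nonneg (c : SingularControl F) (s : ℝ≥0) (ω : Ω) : 0 ≤ c.up s ω :=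
  (c.nonneg_up ω).trans (c.mono_up ω zero_le)

theorem SingularControl.down_nonneg (c : SingularControl F) (s : ℝ≥0) (ω : Ω) : 0 ≤ c.down s ω :=
  (c.nonneg_down ω).trans (c.mono_down ω zero_le)

theorem SingularControl.path_coe (c : SingularControl F) {S s : ℝ≥0} (hs : s ≤ S) (ω : Ω) :
    c.path S ω s = c.process s ω := by
  simp [path, hs]

theorem SingularControl.rightContinuous_path (c : SingularControl F) (S : ℝ≥0) (ω : Ω) (s : ℝ) :
    ContinuousWithinAt (c.path S ω) (Ici s) s := by
  rcases lt_or_ge s 0 with hs | hs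
  · refine (continuousWithinAt_const (b := (0 : ℝ))).congr_of_eventuallyEq ?_ (if_pos hs)
    filter_upwards [mem_nhdsWithin_of_mem_nhds (Iio_mem_nhds hs)] with u hu
    exact if_pos hu
  · have h1 : ContinuousWithinAt (fun u => c.process u ω) (Ici (min s.toNNReal S))
        (min s.toNNReal S) := (c.rightCont_up ω _).sub (c.rightCont_down ω _)
    have h2 : ContinuousWithinAt (fun u : ℝ => min u.toNNReal S) (Ici s) s :=
      (continuous_real_toNNReal.min continuous_const).continuousWithinAt
    refine (ContinuousWithinAt.comp (f := fun u : ℝ => min u.toNNReal S) (x := s) h1 h2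
      fun u hu => min_le_min_right _ (Real.toNNReal_le_toNNReal hu)).congr
      (fun u hu => ?_) ?_
    · exact if_neg (not_lt.2 (hs.trans hu))
    · exact if_neg (not_lt.2 hs)

section Restart

variable (c : SingularControl F) {X Z : ℝ≥0 → Ω → ℝ} (hX : Adapted F X) (hZ : Adapted F Z)
  (hXc : IsCadlag X) (hZc : IsCadlag Z)

theorem SingularControl.process_restart (s : ℝ≥0) (ω : Ω) :
    (c.restart hX hZ hXc hZc).process s ω =
      restartPath (fun u => X u ω - Z u ω) (fun u => c.process u ω)
        (X (crossingTime fun u => X u ω - Z u ω) ω -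
          Z (crossingTime fun u => X u ω - Z u ω) ω) s := by
  have h : ∀ z : ℝ, max z 0 - max (-z) 0 = z := fun z => by
    rcases le_total 0 z with hz | hz
    · rw [max_eq_left hz, max_eq_right (by linarith)]; ring
    · rw [max_eq_right hz, max_eq_left (by linarith)]; ring
  simp only [process, restart, restartPath]
  split_ifs
  · linarith [h (X (crossingTime fun u => X u ω - Z u ω) ω -
      Z (crossingTime fun u => X u ω - Z u ω) ω)]
  · ring

variable {d : GameData} {S : ℝ≥0} {x y : ℝ} {I J : ℝ≥0 → ℝ} {ω : Ω}

/-- The jump of the restarted control at the crossing time is at most that of `c`. -/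
theorem CoupledPaths.exists_leftLimit_path (h : CoupledPaths d S x y (fun s => X s ω)
      (fun s => Z s ω) (fun s => c.process s ω) I J)
    (hc : Crossed (fun u => X u ω - Z u ω) S) :
    ∃ l : ℝ, Tendsto (c.path S ω) (𝓝[<] ((crossingTime fun u => X u ω - Z u ω : ℝ≥0) : ℝ)) (𝓝 l) ∧
      |X (crossingTime fun u => X u ω - Z u ω) ω - Z (crossingTime fun u => X u ω - Z u ω) ω| ≤
        |c.process (crossingTime fun u => X u ω - Z u ω) ω - l| ∧
      max (X (crossingTime fun u => X u ω - Z u ω) ω -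
        Z (crossingTime fun u => X u ω - Z u ω) ω) 0 ≤ c.up (crossingTime fun u => X u ω - Z u ω) ω ∧
      max (-(X (crossingTime fun u => X u ω - Z u ω) ω -
        Z (crossingTime fun u => X u ω - Z u ω) ω)) 0 ≤
          c.down (crossingTime fun u => X u ω - Z u ω) ω := by
  obtain ⟨l₁, h10, h11, h12⟩ :=
    exists_leftLimit_extension (c.mono_up ω) (c.nonneg_up ω) hc.crossingTime_le
  obtain ⟨l₂, h20, h21, h22⟩ :=
    exists_leftLimit_extension (c.mono_down ω) (c.nonneg_down ω) hc.crossingTime_le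
  have hl : Tendsto (c.path S ω) (𝓝[<] ((crossingTime fun u => X u ω - Z u ω : ℝ≥0) : ℝ))
      (𝓝 (l₁ - l₂)) := by
    refine (h12.sub h22).congr fun s => ?_
    simp only [SingularControl.path, SingularControl.process]
    split_ifs <;> simp
  have hj := h.jump (a := c.path S ω) (fun s hs => if_pos hs) (fun s hs => c.path_coe hs ω) hc hl
  have hp : c.process (crossingTime fun u => X u ω - Z u ω) ω =
    c.up (crossingTime fun u => X u ω - Z u ω) ω -
      c.down (crossingTime fun u => X u ω - Z u ω) ω := rfl
  refine ⟨_, hl, ?_⟩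
  generalize (crossingTime fun u => X u ω - Z u ω) = ρ at *
  -- The jump of `c` is the upward jump minus the downward one; as `0 ≤ l₁ ≤ up` and `0 ≤ l₂ ≤ down`
  -- at `ρ`, its positive part is at most `up` and its negative part at most `down`.
  rcases le_or_gt (X ρ ω - Z ρ ω) 0 with hneg | hpos
  · have h1 := hj.1 hneg
    refine ⟨?_, ?_, ?_⟩
    · rw [abs_of_nonpos hneg, abs_of_nonpos (h1.trans hneg)]
      linarith
    · rw [max_eq_right hneg]
      exact c.up_nonneg _ _
    · rw [max_eq_left (by linarith)]
      linarith
  · have h1 := hj.2 hpos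
    refine ⟨by rw [h1], ?_, ?_⟩
    · rw [max_eq_left hpos.le]
      linarith
    · rw [max_eq_right (by linarith)]
      exact c.down_nonneg _ _

theorem CoupledPaths.restart_up_le (h : CoupledPaths d S x y (fun s => X s ω)
      (fun s => Z s ω) (fun s => c.process s ω) I J) :
    (c.restart hX hZ hXc hZc).up S ω ≤ c.up S ω := by
  refine restartPath_le (fun s => c.up_nonneg s ω) S fun hc => ?_
  obtain ⟨l, -, -, h1, -⟩ := h.exists_leftLimit_path c hc
  exact h1

theorem CoupledPaths.restart_down_le (h : CoupledPaths d S x y (fun s => X s ω)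
      (fun s => Z s ω) (fun s => c.process s ω) I J) :
    (c.restart hX hZ hXc hZc).down S ω ≤ c.down S ω := by
  refine restartPath_le (fun s => c.down_nonneg s ω) S fun hc => ?_
  obtain ⟨l, -, -, -, h1⟩ := h.exists_leftLimit_path c hc
  exact h1

theorem CoupledPaths.totalVariation_restart_le (h : CoupledPaths d S x y (fun s => X s ω)
      (fun s => Z s ω) (fun s => c.process s ω) I J) :
    (c.restart hX hZ hXc hZc).totalVariation S ω ≤ c.totalVariation S ω := by
  have hb := (c.restart hX hZ hXc hZc).boundedVariationOn_path S ω
  have ha := c.boundedVariationOn_path S ω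
  by_cases hc : Crossed (fun u => X u ω - Z u ω) S
  · obtain ⟨l, hl, hle, -, -⟩ := h.exists_leftLimit_path c hc
    have hρS := hc.crossingTime_le
    have hiff : ∀ u, Crossed (fun u => X u ω - Z u ω) u ↔
        crossingTime (fun u => X u ω - Z u ω) ≤ u :=
      fun u => hc.crossed_iff fun s => (hXc ω s).1.sub (hZc ω s).1
    rw [← c.path_coe hρS] at hle
    refine variation_restart_le ha hb (c.rightContinuous_path S ω) (fun s => ?_) hl hle
    rw [c.path_coe hρS]
    simp only [SingularControl.path, SingularControl.process_restart, restartPath, hiff]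
    generalize (crossingTime fun u => X u ω - Z u ω) = ρ at *
    rcases lt_or_ge s 0 with hs | hs
    · rw [if_pos hs, if_pos (hs.trans_le NNReal.zero_le_coe)]
    · rw [if_neg (not_lt.2 hs), if_neg (not_lt.2 hs)]
      by_cases hsρ : s < ρ
      · rw [if_pos hsρ, if_neg]
        exact not_le.2 ((min_le_left _ _).trans_lt ((Real.toNNReal_lt_iff_lt_coe hs).2 hsρ))
      · rw [if_neg hsρ, if_pos]
        exact le_min (NNReal.le_toNNReal_of_coe_le (not_lt.1 hsρ)) hρS
  · have hconst : ∀ s : ℝ, S ≤ s → c.path S ω s = c.process S ω := fun s hs => by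
      rw [SingularControl.path, if_neg (not_lt.2 (NNReal.zero_le_coe.trans hs)),
        min_eq_right (NNReal.le_toNNReal_of_coe_le hs)]
    -- Without a crossing the new control is zero on the horizon: a restart at `S` with no jump, as
    -- paths are frozen after `S`.
    refine variation_restart_le (ρ := S) (J := 0) ha hb (c.rightContinuous_path S ω) (fun s => ?_)
      (ha.tendsto_leftLim _) (by simp)
    have h0 : (c.restart hX hZ hXc hZc).path S ω s = 0 := by
      rw [SingularControl.path, SingularControl.process_restart]
      split_ifs
      · rfl
      · exact if_neg fun hcs => hc (hcs.mono (min_le_right _ _))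
    rw [h0]
    split_ifs with hs
    · rfl
    · rw [hconst s (not_lt.1 hs), hconst S le_rfl]
      ring

end Restart

/-! ### Exit times -/

/-- Were the state still in the open set `O`, right-continuity would delay the exit. Strictness
excludes the default value `S`, where the state may be in `O`. -/
theorem exitTime_notMem {O : Set ℝ} (hO : IsOpen O) {S : ℝ≥0} {X : ℝ≥0 → Ω → ℝ} {ω : Ω}
    (hX : CadlagPath fun s => X s ω) (h : exitTime O S X ω < S) : X (exitTime O S X ω) ω ∉ O := by
  intro hmem
  obtain ⟨v, hv, hIco⟩ := mem_nhdsGE_iff_exists_Ico_subset.1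
    ((hX (exitTime O S X ω)).1.tendsto.eventually (hO.mem_nhds hmem))
  obtain ⟨u, hu, hlt⟩ := exists_lt_of_csInf_lt (s := {s | s ≤ S ∧ X s ω ∉ O} ∪ {S})
    ⟨S, Or.inr rfl⟩ (lt_min hv h)
  have hle : exitTime O S X ω ≤ u := csInf_le (OrderBot.bddBelow _) hu
  rcases hu with hu | hu
  · exact hu.2 (hIco ⟨hle, hlt.trans_le (min_le_left _ _)⟩)
  · exact absurd (hlt.trans_le (min_le_right _ _)) (not_lt.2 (le_of_eq hu.symm))

theorem exitTime_congr {O : Set ℝ} {S : ℝ≥0} {X Y : ℝ≥0 → Ω → ℝ} {ω : Ω}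
    (h : ∀ s ≤ S, (Y s ω ∈ O ↔ X s ω ∈ O)) : exitTime O S Y ω = exitTime O S X ω := by
  have : {s | s ≤ S ∧ Y s ω ∉ O} = {s | s ≤ S ∧ X s ω ∉ O} := by
    ext s
    exact and_congr_right fun hs => not_congr (h s hs)
  rw [exitTime, exitTime, this]

theorem exitTime_le (O : Set ℝ) (S : ℝ≥0) (X : ℝ≥0 → Ω → ℝ) (ω : Ω) : exitTime O S X ω ≤ S :=
  csInf_le (OrderBot.bddBelow _) (Or.inr rfl)

/-! ### The state space, the volatility and monotonicity of the running payoff -/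

section StateSpace

variable {d : GameData}

theorem GameData.BasicConditions.isOpen (hd : d.BasicConditions) : IsOpen d.O := by
  rcases hd.O_cases with h | h <;> rw [h]
  exacts [isOpen_univ, isOpen_Ioi]

theorem GameData.BasicConditions.convex_closure (hd : d.BasicConditions) :
    Convex ℝ (closure d.O) := by
  rcases hd.O_cases with h | h <;> rw [h]
  exacts [convex_univ.closure, (convex_Ioi 0).closure]

theorem GameData.BasicConditions.interior_closure (hd : d.BasicConditions) :
    interior (closure d.O) = d.O := by
  rcases hd.O_cases with h | h <;> rw [h] <;> simp

theorem GameData.BasicConditions.isUpperSet (hd : d.BasicConditions) : IsUpperSet d.O := by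
  rcases hd.O_cases with h | h <;> rw [h]
  exacts [isUpperSet_univ, isUpperSet_Ioi 0]

theorem GameData.BasicConditions.lt_of_notMem (hd : d.BasicConditions) {a b : ℝ}
    (ha : a ∉ d.O) (hb : b ∈ d.O) : a < b :=
  not_le.1 fun h => ha (hd.isUpperSet h hb)

/-- `K` is 0 for constant volatility and `σ₁` for linear volatility; this is the bound by `K * D`
needed when the integrands are switched. -/
theorem GameData.CoefficientConditions.exists_lipschitz_σ (hd : d.BasicConditions)
    (hcoef : d.CoefficientConditions) :
    ∃ K : ℝ, ∀ a ∈ closure d.O, ∀ b ∈ closure d.O, |d.σ a - d.σ b| ≤ |K * (b - a)| := by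
  rcases hd.O_cases with h | h
  · obtain ⟨σ₀, -, hσ⟩ := hcoef.σ_const h
    exact ⟨0, fun a _ b _ => by simp [hσ]⟩
  · obtain ⟨σ₁, -, hσ⟩ := hcoef.σ_linear h
    refine ⟨σ₁, fun a ha b hb => ?_⟩
    rw [hσ a ha, hσ b hb, ← mul_sub, abs_mul, abs_mul, abs_sub_comm]

theorem GameData.PayoffConditions.continuousOn_h (hpay : d.PayoffConditions) :
    ContinuousOn (fun p : ℝ × ℝ => d.h p.1 p.2) (Icc 0 d.T ×ˢ closure d.O) :=
  hpay.h_holder.continuousOn (isClosed_Icc.prod isClosed_closure)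

/-- The sign of the derivative inside `O` extends to the boundary by continuity; the closure is
needed since a controlled path may sit at 0. -/
theorem GameData.PayoffConditions.monotoneOn_h (hd : d.BasicConditions)
    (hpay : d.PayoffConditions) {t : ℝ} (ht : t ∈ Icc 0 d.T) :
    MonotoneOn (d.h t) (closure d.O) := by
  refine monotoneOn_of_deriv_nonneg hd.convex_closure ?_ ?_ ?_
  · exact hpay.continuousOn_h.comp (f := fun z : ℝ => (t, z)) (by fun_prop) fun z hz => ⟨ht, hz⟩
  · rw [hd.interior_closure]
    exact hpay.h_diff t ht
  · rw [hd.interior_closure]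
    exact hpay.hx_nonneg t ht

/-- Before the crossing `Z` lies in `O` and `X` above it, so both states are in `O`; afterwards they
coincide. Hence the exit times agree. -/
theorem CoupledPaths.switchPath_mem_iff (hd : d.BasicConditions) {S : ℝ≥0} {x y : ℝ}
    {X Z n I J : ℝ≥0 → ℝ} (h : CoupledPaths d S x y X Z n I J) {s : ℝ≥0} (hs : s ≤ S) :
    switchPath X Z s ∈ d.O ↔ X s ∈ d.O := by
  unfold switchPath
  split_ifs with hc
  · rfl
  · refine iff_of_true (h.mem_Z s hs) (hd.isUpperSet ?_ (h.mem_Z s hs))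
    linarith [pos_of_not_crossed hc]

end StateSpace

/-! ### Comparison of payoffs -/

/-- The positive part increases, the negative part decreases, and subtraction in `EReal` respects
this even at infinite values, so no integrability is required. -/
theorem expectation_mono {P : Measure Ω} {Y Z : Ω → ℝ} (h : ∀ᵐ ω ∂P, Y ω ≤ Z ω) :
    expectation P Y ≤ expectation P Z := by
  refine EReal.sub_le_sub ?_ ?_
  · exact EReal.coe_ennreal_le_coe_ennreal_iff.2 (lintegral_mono_ae
      (h.mono fun ω hω => ENNReal.ofReal_le_ofReal hω))
  · exact EReal.coe_ennreal_le_coe_ennreal_iff.2 (lintegral_mono_ae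
      (h.mono fun ω hω => ENNReal.ofReal_le_ofReal (neg_le_neg hω)))

theorem payoff_mono {d : GameData} (hd : d.BasicConditions) (hpay : d.PayoffConditions) {t : ℝ}
    (ht : t ∈ Icc 0 d.T) {c c' : SingularControl F} {X Y : ℝ≥0 → Ω → ℝ} {ω : Ω}
    (hX : CadlagPath fun s => X s ω) (hY : CadlagPath fun s => Y s ω)
    (hXO : ∀ s ≤ d.horizon t, X s ω ∈ closure d.O) (hYO : ∀ s ≤ d.horizon t, Y s ω ∈ closure d.O)
    (hYX : ∀ s, Y s ω ≤ X s ω)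
    (hv : c'.totalVariation (d.horizon t) ω ≤ c.totalVariation (d.horizon t) ω) {u : ℝ≥0}
    (hu : u ≤ d.horizon t) :
    payoff d t c' Y u ω ≤ payoff d t c X u ω := by
  have hS : ((d.horizon t : ℝ≥0) : ℝ) = d.T - t := Real.coe_toNNReal _ (sub_nonneg.2 ht.2)
  have hu' : (u : ℝ) ≤ d.T - t := hS ▸ NNReal.coe_le_coe.2 hu
  have hint : ∀ f : ℝ≥0 → ℝ, CadlagPath f → (∀ s ≤ d.horizon t, f s ∈ closure d.O) →
      IntervalIntegrable (fun s : ℝ => Real.exp (-d.r * s) * d.h (t + s) (f s.toNNReal))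
        volume 0 u := by
    intro f hf hfO
    refine IntervalIntegrable.continuousOn_mul ?_ (by fun_prop)
    exact intervalIntegrable_comp_cadlag (G := fun p => d.h p.1 p.2) isClosed_closure ht.1
      (by linarith) hpay.continuousOn_h hf fun s hs => hfO s (hs.trans hu)
  unfold payoff
  refine add_le_add (add_le_add le_rfl ?_) ?_
  · refine intervalIntegral.integral_mono_on NNReal.zero_le_coe (hint _ hY hYO) (hint _ hX hXO)
      fun s hs => ?_
    have hs' : s.toNNReal ≤ d.horizon t := (Real.toNNReal_le_iff_le_coe.2 hs.2).trans hu
    refine mul_le_mul_of_nonneg_left ?_ (Real.exp_pos _).le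
    exact hpay.monotoneOn_h hd ⟨by linarith [ht.1, hs.1], by linarith [hs.2]⟩ (hYO _ hs')
      (hXO _ hs') (hYX _)
  -- Finiteness of the larger measure makes the discount factor integrable, which the comparison of
  -- Bochner integrals requires.
  · have : IsFiniteMeasure (c.totalVariation (d.horizon t) ω) :=
      isFiniteMeasure_variation_signedMeasure _
    refine integral_mono_measure (Measure.restrict_mono le_rfl hv) ?_ ?_
    · exact ae_of_all _ fun s => mul_nonneg (Real.exp_pos _).le hd.α₀_pos.le
    · exact ContinuousOn.integrableOn_Icc (by fun_prop)

end Control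

/-! ### Monotonicity of the values -/

section Main

variable {Ω : Type*} {m : MeasurableSpace Ω} {P : Measure Ω} {F : Filtration ℝ≥0 m}
  {W : ℝ≥0 → Ω → ℝ} {d : GameData}

theorem GameData.horizon_le {t : ℝ} (ht : 0 ≤ t) : d.horizon t ≤ d.T.toNNReal :=
  Real.toNNReal_le_toNNReal (by linarith)

theorem IsAdmissible.exists_coupledPaths (hW : IsFiltrationBrownian P F W)
    (hcoef : d.CoefficientConditions) {t x y : ℝ} (ht : t ∈ Icc 0 d.T) (hxy : x ≤ y)
    {c : SingularControl F} {X Z : ℝ≥0 → Ω → ℝ} (hX : IsAdmissible d P F W t y c X)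
    (hZ : IsSolution d P F W x (fun _ _ => 0) Z d.T.toNNReal)
    (hZO : ∀ᵐ ω ∂P, ∀ s ≤ d.T.toNNReal, Z s ω ∈ d.O) :
    ∃ I J : ℝ≥0 → Ω → ℝ,
      IsItoIntegral P (fun s ω => d.σ (X s ω)) W I (d.horizon t) ∧
      IsItoIntegral P (fun s ω => d.σ (Z s ω)) W J (d.horizon t) ∧
      ∀ᵐ ω ∂P, CoupledPaths d (d.horizon t) x y (fun s => X s ω) (fun s => Z s ω)
        (fun s => c.process s ω) (fun s => I s ω) (fun s => J s ω) := by
  obtain ⟨I, hI, hXeq⟩ := hX.solution.sde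
  obtain ⟨J, hJT, hZeq⟩ := hZ.sde
  have hT := d.horizon_le ht.1
  have hJ := hJT.restrict hT
  refine ⟨I, J, hI, hJ, ?_⟩
  filter_upwards [hXeq, hZeq, hZO, hX.state, hI.ae_continuousOn hW.brownian.cont,
    hJ.ae_continuousOn hW.brownian.cont] with ω h1 h2 h3 h4 h5 h6
  exact ⟨hxy, hcoef.μ_contDiff.continuousOn, hX.solution.cadlag ω, hZ.cadlag ω, h1,
    fun s hs => h2 s (hs.trans hT), h5, h6, h4, fun s hs => h3 s (hs.trans hT)⟩

theorem IsAdmissible.restart [IsProbabilityMeasure P] (hW : IsFiltrationBrownian P F W)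
    (hd : d.BasicConditions) (hcoef : d.CoefficientConditions) {t x y : ℝ} {c : SingularControl F}
    {X Z I J : ℝ≥0 → Ω → ℝ} (hX : IsAdmissible d P F W t y c X) (hZa : Adapted F Z)
    (hZc : IsCadlag Z) (hI : IsItoIntegral P (fun s ω => d.σ (X s ω)) W I (d.horizon t))
    (hJ : IsItoIntegral P (fun s ω => d.σ (Z s ω)) W J (d.horizon t))
    (hcp : ∀ᵐ ω ∂P, CoupledPaths d (d.horizon t) x y (fun s => X s ω) (fun s => Z s ω)
        (fun s => c.process s ω) (fun s => I s ω) (fun s => J s ω)) :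
    IsAdmissible d P F W t x
      (c.restart hX.solution.adapted hZa hX.solution.cadlag hZc)
      (fun s ω => switchPath (fun u => X u ω) (fun u => Z u ω) s) := by
  classical
  have hXa := hX.solution.adapted
  have hXc := hX.solution.cadlag
  have hDa : Adapted F fun u ω => X u ω - Z u ω := fun s => (hXa s).sub (hZa s)
  have hDc : ∀ ω, CadlagPath fun u => X u ω - Z u ω := fun ω =>
    CadlagPath.sub (hXc ω) (hZc ω)
  have hDr : ∀ ω s, ContinuousWithinAt (fun u => X u ω - Z u ω) (Ici s) s := fun ω s =>
    (hDc ω s).1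
  refine ⟨⟨fun s => ?_, fun ω => ?_, ?_⟩, ?_, ?_, ?_, ?_⟩
  · exact Measurable.ite (measurableSet_crossed hDa hDr s) (hXa s) (hZa s)
  · exact cadlagPath_ite_crossed (hDr ω) (hXc ω) (hZc ω)
  · obtain ⟨K, hK⟩ := hcoef.exists_lipschitz_σ hd
    have hH : ∀ᵐ ω ∂P, ∀ s ≤ d.horizon t,
        |d.σ (Z s ω) - d.σ (X s ω)| ≤ |K * (X s ω - Z s ω)| := by
      filter_upwards [hcp] with ω h s hs
      exact hK _ (subset_closure (h.mem_Z s hs)) _ (h.mem_X s hs)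
    have hIto := IsItoIntegral.ite_crossed (fun s => hDa.measurable (i := s)) hDc
      (fun s => hW.adapted.measurable (i := s)) hW.brownian.cont hJ hI hH
    have hσ : (fun s ω => d.σ (switchPath (fun u => X u ω) (fun u => Z u ω) s)) =
        fun s ω => if Crossed (fun u => X u ω - Z u ω) s then d.σ (X s ω) else d.σ (Z s ω) :=
      funext₂ fun s ω => apply_ite d.σ _ _ _
    rw [← hσ] at hIto
    refine ⟨_, hIto, ?_⟩
    filter_upwards [hcp] with ω h s hs
    rw [SingularControl.process_restart]
    exact h.switchPath_eq hs
  · refine hX.sq_up.mono ((c.restart hXa hZa hXc hZc).adapted_up.measurable.aestronglyMeasurable) ?_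
    filter_upwards [hcp] with ω h
    rw [Real.norm_of_nonneg (SingularControl.up_nonneg _ _ _),
      Real.norm_of_nonneg (SingularControl.up_nonneg _ _ _)]
    exact h.restart_up_le c hXa hZa hXc hZc
  · refine hX.sq_down.mono
      ((c.restart hXa hZa hXc hZc).adapted_down.measurable.aestronglyMeasurable) ?_
    filter_upwards [hcp] with ω h
    rw [Real.norm_of_nonneg (SingularControl.down_nonneg _ _ _),
      Real.norm_of_nonneg (SingularControl.down_nonneg _ _ _)]
    exact h.restart_down_le c hXa hZa hXc hZc
  · filter_upwards [hcp] with ω h s hs using h.switchPath_mem hs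
  · filter_upwards [hcp, hX.absorbed] with ω h habs s hs hes
    have hexit := exitTime_congr (O := d.O) (X := X) (ω := ω)
      (Y := fun s ω => switchPath (fun u => X u ω) (fun u => Z u ω) s)
      fun s hs => h.switchPath_mem_iff hd hs
    rw [hexit] at hes ⊢
    rcases (exitTime_le d.O (d.horizon t) X ω).lt_or_eq with hlt | heq
    · have hnot := exitTime_notMem hd.isOpen (hXc ω) hlt
      -- At an exit before the horizon `X` is outside `O` and `Z` inside, so `X < Z` and the
      -- crossing has happened; from then on the new control has the increments of `c`, which is
      -- already constant.
      have hcross : Crossed (fun u => X u ω - Z u ω) (exitTime d.O (d.horizon t) X ω) :=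
        crossed_of_nonpos (sub_nonpos.2 (hd.lt_of_notMem hnot (h.mem_Z _ hlt.le)).le)
      have := habs s hs hes
      simp only [SingularControl.restart, restartPath, if_pos hcross, if_pos (hcross.mono hes),
        this.1, this.2, and_self]
    · have : s = exitTime d.O (d.horizon t) X ω := le_antisymm (hs.trans_eq heq.symm) hes
      rw [← this]
      exact ⟨rfl, rfl⟩

/-- Every control for `(t,y)` can be matched by a control for `(t,x)`, `x ≤ y`, which is better for
the minimiser whatever the stopping time. -/
theorem exists_control_expectedPayoff_le [IsProbabilityMeasure P] (hW : IsFiltrationBrownian P F W)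
    (hd : d.BasicConditions) (hcoef : d.CoefficientConditions) (hpay : d.PayoffConditions)
    (hX : UncontrolledDynamics d P F W) {t x y : ℝ} (ht : t ∈ Icc 0 d.T) (hx : x ∈ d.O)
    (hxy : x ≤ y) (ν : Controls d P F W t y) :
    ∃ ν' : Controls d P F W t x, ∀ τ : StoppingTimes d P F t,
      expectedPayoff d P F W t x τ ν' ≤ expectedPayoff d P F W t y τ ν := by
  obtain ⟨⟨c, X⟩, hν⟩ := ν
  obtain ⟨Z, hZ, hZO⟩ := hX x hx
  obtain ⟨I, J, hI, hJ, hcp⟩ := hν.exists_coupledPaths hW hcoef ht hxy hZ hZO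
  let Y : ℝ≥0 → Ω → ℝ := fun s ω => switchPath (fun u => X u ω) (fun u => Z u ω) s
  let c' := c.restart hν.solution.adapted hZ.adapted hν.solution.cadlag hZ.cadlag
  have hY : IsAdmissible d P F W t x c' Y := hν.restart hW hd hcoef hZ.adapted hZ.cadlag hI hJ hcp
  refine ⟨⟨(c', Y), hY⟩, fun τ => expectation_mono ?_⟩
  filter_upwards [hcp] with ω h
  have hexit : exitTime d.O (d.horizon t) Y ω = exitTime d.O (d.horizon t) X ω :=
    exitTime_congr fun s hs => h.switchPath_mem_iff hd hs
  change payoff d t c' Y (min (τ.1 ω) (exitTime d.O (d.horizon t) Y ω)) ω ≤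
    payoff d t c X (min (τ.1 ω) (exitTime d.O (d.horizon t) X ω)) ω
  rw [hexit]
  exact payoff_mono hd hpay ht h.cadlag_X h.cadlag_switchPath h.mem_X
    (fun s hs => h.switchPath_mem hs) (fun s => CoupledPaths.switchPath_le s)
    (h.totalVariation_restart_le c _ _ _ _) ((min_le_right _ _).trans (exitTime_le _ _ _ _))

end Main

end StopperGame

theorem proposition3p1 {Ω : Type*} {m : MeasurableSpace Ω} (P : Measure Ω)
    [IsProbabilityMeasure P] (F : Filtration ℝ≥0 m) (W : ℝ≥0 → Ω → ℝ)
    (hW : StopperGame.IsFiltrationBrownian P F W)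
    (d : StopperGame.GameData) (hd : d.BasicConditions)
    (hcoef : d.CoefficientConditions) (hpay : d.PayoffConditions)
    (hX : StopperGame.UncontrolledDynamics d P F W) :
    (∀ t ∈ Icc 0 d.T,
      MonotoneOn (StopperGame.upperValue d P F W t) d.O ∧
      MonotoneOn (StopperGame.lowerValue d P F W t) d.O) ∧
    ∀ v : ℝ → ℝ → ℝ, StopperGame.IsValue d P F W v → ∀ t ∈ Icc 0 d.T,
      MonotoneOn (v t) d.O ∧
      ∀ x ∈ d.O, ∀ v' : ℝ, HasDerivAt (v t) v' x → 0 ≤ v' := by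
  have hmono : ∀ t ∈ Icc 0 d.T,
      MonotoneOn (StopperGame.upperValue d P F W t) d.O ∧
      MonotoneOn (StopperGame.lowerValue d P F W t) d.O := by
    -- The matching control does not depend on `τ`, and stopping times do not depend on the starting
    -- point, so one construction serves both orders of inf and sup.
    refine fun t ht => ⟨fun x hx y _ hxy => le_iInf fun ν => ?_,
      fun x hx y _ hxy => iSup_mono fun τ => le_iInf fun ν => ?_⟩ <;>
    obtain ⟨ν', hν'⟩ := StopperGame.exists_control_expectedPayoff_le hW hd hcoef hpay hX ht hx hxy ν
    · exact (iInf_le _ ν').trans (iSup_mono hν')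
    · exact (iInf_le _ ν').trans (hν' τ)
  refine ⟨hmono, fun v hv t ht => ?_⟩
  have hvm : MonotoneOn (v t) d.O := fun x hx y hy hxy => by
    have h := (hmono t ht).1 hx hy hxy
    rw [(hv t ht x hx).1, (hv t ht y hy).1] at h
    exact EReal.coe_le_coe_iff.1 h
  refine ⟨hvm, fun x hx v' hv' => ?_⟩
  have hacc : AccPt x (𝓟 d.O) := accPt_iff_frequently_nhdsNE.2
    (Eventually.frequently (mem_nhdsWithin_of_mem_nhds (hd.isOpen.mem_nhds hx)))
  exact hv'.hasDerivWithinAt.nonneg_of_monotoneOn hacc hvm
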